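/- **Setting.** Fix a set of built-in unitary gates of arity 1 or 2. *Terms* (modulo $\alpha$-equivalence) are $$M,N,P ::= x \mid\, !M \mid \lambda x.M \mid \lambda^! x.M \mid MN \mid r_i \mid U_A \mid \mathsf{new} \mid \mathsf{meas}(P,M,N),$$ with $r_i$ ($i\in\mathbb N$) registers and $A$ a gate; $\langle M,N\rangle := \lambda f.fMN$ with $f$ fresh. A *surface* context is a one-hole term context whose hole is neither in the scope of $!$ nor in the branches $M,N$ of a $\mathsf{meas}(P,M,N)$. A term is *valid* if no register occurs in it more than once, all its registers occur at surface positions, and for every subterm $\lambda x.P$ the variable $x$ occurs free exactly once in $P$, at a surface position of $P$. A *program* is a pair $[Q,M]$ of a normalized vector $Q\in(\mathbb C^2)^{\otimes n}$, for some $n\ge 0$, and a valid term $M$ whose registers are exactly $r_0,\dots,r_{n-1}$, taken modulo simultaneous permutation of the qubits and of the registers. A *multidistribution* is a finite multiset $\mathbf m=[p_i\,\mathbf e_i]_{i\in I}$ of programs $\mathbf e_i$ with weights $p_i\in\,]0,1]$, $\sum_i p_i\le 1$; $[\mathbf e]$ stands for $[1\,\mathbf e]$. The root $\beta$-rules are $[Q,(\lambda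 x.M)N]\mapsto[\,[Q,M\{N/x\}]\,]$ and $[Q,(\lambda^! x.M)\,!N]\mapsto[\,[Q,M\{N/x\}]\,]$. The quantum root rules, stated on suitable representatives modulo re-indexing, are: * $[Q,\mathsf{new}]\mapsto[\,[Q\otimes|0\rangle,r_n]\,]$, where $Q$ has $n$ qubits; * $[Q,\mathsf{meas}(r_n,M,N)]\mapsto[\,|\alpha_0|^2[Q_0,M],\,|\alpha_1|^2[Q_1,N]\,]$, where $Q$ has $n+1$ qubits, $Q=\alpha_0 Q_0\otimes|0\rangle+\alpha_1Q_1\otimes|1\rangle$ with $Q_0,Q_1$ normalized, and entries of weight $0$ are omitted; * $[Q,U_A r_0]\mapsto[\,[(A\otimes\mathrm{Id})Q,r_0]\,]$ for unary $A$; * $[Q,U_A\langle r_0,r_1\rangle]\mapsto[\,[(A\otimes\mathrm{Id})Q,\langle r_0,r_1\rangle]\,]$ for binary $A$. General steps $\mathbf e\to\mathbf m$ are obtained by closing the $\beta$-rules under all contexts and the quantum rules under surface contexts; surface steps $\mathbf e\to_s\mathbf m$ by closing both kinds of rules under surface contexts. A program is in *surface normal form* if it has no surface step. The general reduction $\Rightarrow$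 on multidistributions is given by $[p_i\mathbf e_i]_{i\in I}\Rightarrow\sum_{i\in I} p_i\cdot\mathbf m_i$ whenever, for each $i$, either $\mathbf m_i=[\mathbf e_i]$ or $\mathbf e_i\to\mathbf m_i$. The strict surface reduction $\Rightarrow_{\!ss}$ is given by the same formula whenever, for each $i$, either $\mathbf e_i\to_s\mathbf m_i$, or $\mathbf e_i$ is in surface normal form and $\mathbf m_i=[\mathbf e_i]$. For $\mathbf m=[p_i\mathbf e_i]_{i\in I}$ let $\Pr(\mathbf m)$ be the sum of the $p_i$ for which $\mathbf e_i$ is in surface normal form. An infinite reduction sequence $\mathbf m_0,\mathbf m_1,\mathbf m_2,\dots$ (either relation; both allow normal forms to stay put) *converges* to surface normal form with probability $\sup_k\Pr(\mathbf m_k)$. **Theorem (Asymptotic completeness).** Let $\mathbf m$ be any multidistribution. If some $\Rightarrow$-sequence from $\mathbf m$ converges to surface normal form with probability $p$, then some $\Rightarrow_{\!ss}$-sequence from $\mathbf m$ converges to surface normal form with probability $q$ for some $q\ge p$. -/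

import Mathlib

namespace QLambda

universe u v

/-- A set of built-in unitary gates, of arity one or two.
A gate acts on bit strings: `|b⟩` for one qubit, `|b c⟩` for two qubits. -/
structure GateSet where
  Un : Type u
  Bin : Type v
  mat1 : Un → Matrix.unitaryGroup Bool ℂ
  mat2 : Bin → Matrix.unitaryGroup (Bool × Bool) ℂ

/-- Raw terms modulo α-equivalence, in de Bruijn notation: `lam` and `blam` bind index `0` of
their body. A dangling index stands for a free variable. `lam` is the linear abstraction `λx.M`,
`blam` the non-linear abstraction `λ!x.M`. -/
inductive Term (G : GateSet.{u, v}) : Type (max u v)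
  | var (k : ℕ)
  | bang (M : Term G)
  | lam (M : Term G)
  | blam (M : Term G)
  | app (M N : Term G)
  | reg (i : ℕ)
  | gate1 (A : G.Un)
  | gate2 (A : G.Bin)
  | new
  | meas (P M N : Term G)

variable {G : GateSet.{u, v}}

namespace Term

/-- Extension of a renaming of indices under one binder. -/
def liftRen (ρ : ℕ → ℕ) : ℕ → ℕ
  | 0 => 0
  | k + 1 => ρ k + 1

def rename : (ℕ → ℕ) → Term G → Term G
  | ρ, var k => var (ρ k)
  | ρ, bang M => bang (rename ρ M)
  | ρ, lam M => lam (rename (liftRen ρ) M)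
  | ρ, blam M => blam (rename (liftRen ρ) M)
  | ρ, app M N => app (rename ρ M) (rename ρ N)
  | _, reg i => reg i
  | _, gate1 A => gate1 A
  | _, gate2 A => gate2 A
  | _, new => new
  | ρ, meas P M N => meas (rename ρ P) (rename ρ M) (rename ρ N)

/-- Extension of a substitution under one binder. -/
def liftSub (s : ℕ → Term G) : ℕ → Term G
  | 0 => var 0
  | k + 1 => rename Nat.succ (s k)

/-- Capture-avoiding simultaneous substitution. -/
def subst : (ℕ → Term G) → Term G → Term G
  | s, var k => s k
  | s, bang M => bang (subst s M)
  | s, lam M => lam (subst (liftSub s) M)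
  | s, blam M => blam (subst (liftSub s) M)
  | s, app M N => app (subst s M) (subst s N)
  | _, reg i => reg i
  | _, gate1 A => gate1 A
  | _, gate2 A => gate2 A
  | _, new => new
  | s, meas P M N => meas (subst s P) (subst s M) (subst s N)

/-- `M.inst N` is `M[N/x]`, where `x` is the variable bound by the abstraction with body `M`. -/
def inst (M N : Term G) : Term G :=
  subst (fun k => match k with
    | 0 => N
    | k + 1 => var k) M

/-- The pair `⟨M, N⟩`, encoded as `λf. f M N`. -/
def pair (M N : Term G) : Term G :=
  lam (app (app (var 0) (rename Nat.succ M)) (rename Nat.succ N))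

/-- Replacement of every register `r_i` by `r_(f i)`. -/
def mapReg (f : ℕ → ℕ) : Term G → Term G
  | var k => var k
  | bang M => bang (mapReg f M)
  | lam M => lam (mapReg f M)
  | blam M => blam (mapReg f M)
  | app M N => app (mapReg f M) (mapReg f N)
  | reg i => reg (f i)
  | gate1 A => gate1 A
  | gate2 A => gate2 A
  | new => new
  | meas P M N => meas (mapReg f P) (mapReg f M) (mapReg f N)

/-- Number of free occurrences of the variable with index `k`. -/
def varOcc : ℕ → Term G → ℕ
  | k, var j => if j = k then 1 else 0
  | k, bang M => varOcc k M
  | k, lam M => varOcc (k + 1) M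
  | k, blam M => varOcc (k + 1) M
  | k, app M N => varOcc k M + varOcc k N
  | _, reg _ => 0
  | _, gate1 _ => 0
  | _, gate2 _ => 0
  | _, new => 0
  | k, meas P M N => varOcc k P + varOcc k M + varOcc k N

/-- Number of free surface occurrences of the variable with index `k`: those that are neither in
the scope of a `!` nor in a branch of a `meas`. -/
def varSurfOcc : ℕ → Term G → ℕ
  | k, var j => if j = k then 1 else 0
  | _, bang _ => 0
  | k, lam M => varSurfOcc (k + 1) M
  | k, blam M => varSurfOcc (k + 1) M
  | k, app M N => varSurfOcc k M + varSurfOcc k N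
  | _, reg _ => 0
  | _, gate1 _ => 0
  | _, gate2 _ => 0
  | _, new => 0
  | k, meas P _ _ => varSurfOcc k P

/-- Number of occurrences of the register `r_i`. -/
def regOcc (i : ℕ) : Term G → ℕ
  | var _ => 0
  | bang M => regOcc i M
  | lam M => regOcc i M
  | blam M => regOcc i M
  | app M N => regOcc i M + regOcc i N
  | reg j => if j = i then 1 else 0
  | gate1 _ => 0
  | gate2 _ => 0
  | new => 0
  | meas P M N => regOcc i P + regOcc i M + regOcc i N

/-- Number of surface occurrences of the register `r_i`. -/
def regSurfOcc (i : ℕ) : Term G → ℕ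
  | var _ => 0
  | bang _ => 0
  | lam M => regSurfOcc i M
  | blam M => regSurfOcc i M
  | app M N => regSurfOcc i M + regSurfOcc i N
  | reg j => if j = i then 1 else 0
  | gate1 _ => 0
  | gate2 _ => 0
  | new => 0
  | meas P _ _ => regSurfOcc i P

/-- In every subterm `λx.P`, the variable `x` occurs free exactly once in `P`, and that
occurrence is surface. -/
def LinearLams : Term G → Prop
  | var _ => True
  | bang M => LinearLams M
  | lam M => varOcc 0 M = 1 ∧ varSurfOcc 0 M = 1 ∧ LinearLams M
  | blam M => LinearLams M
  | app M N => LinearLams M ∧ LinearLams N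
  | reg _ => True
  | gate1 _ => True
  | gate2 _ => True
  | new => True
  | meas P M N => LinearLams P ∧ LinearLams M ∧ LinearLams N

/-- Valid terms: no register occurs more than once, all occurrences of registers are surface, and
every linear abstraction is linear. -/
def Valid (M : Term G) : Prop :=
  (∀ i, regOcc i M ≤ 1 ∧ regSurfOcc i M = regOcc i M) ∧ LinearLams M

theorem mapReg_mapReg (f g : ℕ → ℕ) (M : Term G) :
    mapReg g (mapReg f M) = mapReg (fun i => g (f i)) M := by
  induction M <;> simp_all [mapReg]

theorem mapReg_id (M : Term G) : mapReg (fun i => i) M = M := by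
  induction M <;> simp_all [mapReg]

end Term

/-- Terms with one hole. -/
inductive Ctx (G : GateSet.{u, v}) : Type (max u v)
  | hole
  | appR (M : Term G) (C : Ctx G)
  | appL (C : Ctx G) (M : Term G)
  | lam (C : Ctx G)
  | blam (C : Ctx G)
  | measS (C : Ctx G) (M N : Term G)
  | measL (P : Term G) (C : Ctx G) (N : Term G)
  | measR (P M : Term G) (C : Ctx G)
  | bang (C : Ctx G)

namespace Ctx

/-- `C.fill R` puts `R` into the hole of `C`, with possible capture of free variables. -/
def fill : Ctx G → Term G → Term G
  | hole, R => R
  | appR M C, R => .app M (fill C R)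
  | appL C M, R => .app (fill C R) M
  | lam C, R => .lam (fill C R)
  | blam C, R => .blam (fill C R)
  | measS C M N, R => .meas (fill C R) M N
  | measL P C N, R => .meas P (fill C R) N
  | measR P M C, R => .meas P M (fill C R)
  | bang C, R => .bang (fill C R)

/-- Surface contexts: the hole is neither in the scope of a `!` nor in a branch of a `meas`. -/
def IsSurface : Ctx G → Prop
  | hole => True
  | appR _ C => IsSurface C
  | appL C _ => IsSurface C
  | lam C => IsSurface C
  | blam C => IsSurface C
  | measS C _ _ => IsSurface C
  | measL _ _ _ => False
  | measR _ _ _ => False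
  | bang _ => False

end Ctx

/-- The space `(ℂ²)^{⊗n}`: a vector is given by its coordinates on the basis `|b_0 … b_{n-1}⟩`. -/
abbrev QState (n : ℕ) : Type := EuclideanSpace ℂ (Fin n → Bool)

namespace QState

/-- `Q ⊗ |b⟩`. -/
noncomputable def snoc {n : ℕ} (Q : QState n) (b : Bool) : QState (n + 1) :=
  WithLp.toLp 2 fun c => if c (Fin.last n) = b then Q (fun i => c i.castSucc) else 0

/-- `(A ⊗ Id) Q` for a one-qubit matrix `A`, acting on qubit `0`. -/
noncomputable def apply1 {n : ℕ} (A : Matrix Bool Bool ℂ) (Q : QState (n + 1)) : QState (n + 1) :=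
  WithLp.toLp 2 fun c => ∑ b : Bool, A (c 0) b * Q (Function.update c 0 b)

/-- `(A ⊗ Id) Q` for a two-qubit matrix `A`, acting on qubits `0` and `1`. -/
noncomputable def apply2 {n : ℕ} (A : Matrix (Bool × Bool) (Bool × Bool) ℂ) (Q : QState (n + 2)) :
    QState (n + 2) :=
  WithLp.toLp 2 fun c =>
    ∑ b : Bool × Bool,
      A (c 0, c 1) b * Q (Function.update (Function.update c 0 b.1) 1 b.2)

end QState

/-- A pair of a vector of some `(ℂ²)^{⊗n}` and a term, without any constraint. -/
structure Conf (G : GateSet.{u, v}) : Type (max u v) where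
  size : ℕ
  state : QState size
  term : Term G

/-- A raw program `[Q, M]`: `Q` is a normalized vector of `(ℂ²)^{⊗n}`, `M` is a valid term and the
registers of `M` are exactly `r_0, …, r_{n-1}`. -/
structure RawProgram (G : GateSet.{u, v}) : Type (max u v) extends Conf G where
  norm_state : ‖state‖ = 1
  valid : term.Valid
  regs : ∀ i, 0 < term.regOcc i ↔ i < size

/-- The action on register identifiers of a bijection of `{0, …, n-1}` with `{0, …, m-1}`
(so `n = m`). -/
def extendReg {n m : ℕ} (σ : Fin n ≃ Fin m) (i : ℕ) : ℕ :=
  if h : i < n then σ ⟨i, h⟩ else i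

theorem extendReg_symm {n m : ℕ} (σ : Fin n ≃ Fin m) (i : ℕ) :
    extendReg σ.symm (extendReg σ i) = i := by
  have e : n = m := Fin.equiv_iff_eq.mp ⟨σ⟩
  unfold extendReg
  by_cases h : i < n
  · simp [h]
  · simp [h, e ▸ h]

theorem extendReg_trans {n m l : ℕ} (σ : Fin n ≃ Fin m) (τ : Fin m ≃ Fin l) (i : ℕ) :
    extendReg τ (extendReg σ i) = extendReg (σ.trans τ) i := by
  have e : n = m := Fin.equiv_iff_eq.mp ⟨σ⟩
  unfold extendReg
  by_cases h : i < n
  · simp [h]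
  · simp [h, e ▸ h]

theorem extendReg_refl (n i : ℕ) : extendReg (Equiv.refl (Fin n)) i = i := by
  simp [extendReg]

/-- `q` is a re-indexing of `p`: qubit number `i` of `p` is qubit number `σ i` of `q`, and the
register `r_i` is replaced by `r_(σ i)`. -/
def Reindex (p q : RawProgram G) : Prop :=
  ∃ σ : Fin p.size ≃ Fin q.size,
    (∀ b : Fin q.size → Bool, q.state b = p.state (fun i => b (σ i))) ∧
      q.term = p.term.mapReg (extendReg σ)

instance reindexSetoid (G : GateSet.{u, v}) : Setoid (RawProgram G) where
  r := Reindex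
  iseqv :=
    { refl := fun p => by
        refine ⟨Equiv.refl _, fun b => rfl, ?_⟩
        have h : extendReg (Equiv.refl (Fin p.size)) = fun i => i :=
          funext (extendReg_refl p.size)
        rw [h, Term.mapReg_id]
      symm := fun {p q} ⟨σ, hs, ht⟩ => by
        refine ⟨σ.symm, fun b => ?_, ?_⟩
        · rw [hs]; simp
        · rw [ht, Term.mapReg_mapReg]
          simp only [extendReg_symm, Term.mapReg_id]
      trans := fun {p q r} ⟨σ, hs, ht⟩ ⟨τ, ks, kt⟩ => by
        refine ⟨σ.trans τ, fun b => ?_, ?_⟩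
        · rw [ks, hs]; rfl
        · rw [kt, ht, Term.mapReg_mapReg]
          simp only [extendReg_trans] }

/-- Programs: raw programs modulo re-indexing. -/
def Program (G : GateSet.{u, v}) : Type (max u v) := Quotient (reindexSetoid G)

/-- The program represented by a raw program. -/
def RawProgram.toProgram (p : RawProgram G) : Program G := Quotient.mk (reindexSetoid G) p

/-- Multidistributions: finite multisets of weighted programs, with weights in `]0,1]` and total
weight at most `1`. -/
def MDist (G : GateSet.{u, v}) : Type (max u v) :=
  {m : Multiset (ℝ × Program G) //
    (∀ x ∈ m, 0 < x.1 ∧ x.1 ≤ 1) ∧ (m.map Prod.fst).sum ≤ 1}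

/-- The multidistribution `⟦1 e⟧`. -/
def MDist.dirac (e : Program G) : MDist G := ⟨{(1, e)}, by simp⟩

/-- `⟦w c⟧`, or the empty multiset if the weight `w` is `0`. -/
noncomputable def outcome (w : ℝ) (c : Conf G) : Multiset (ℝ × Conf G) :=
  open Classical in if w = 0 then 0 else {(w, c)}

/-- Root rules (b) and (!b). -/
inductive RootBeta : Conf G → Multiset (ℝ × Conf G) → Prop
  | b {n : ℕ} (Q : QState n) (M N : Term G) :
      RootBeta ⟨n, Q, .app (.lam M) N⟩ {(1, ⟨n, Q, M.inst N⟩)}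
  | bb {n : ℕ} (Q : QState n) (M N : Term G) :
      RootBeta ⟨n, Q, .app (.blam M) (.bang N)⟩ {(1, ⟨n, Q, M.inst N⟩)}

/-- Quantum root rules: allocation, measurement (of the last qubit, which is discarded), unary
gates (on qubit `0`) and binary gates (on qubits `0` and `1`). -/
inductive RootQ : Conf G → Multiset (ℝ × Conf G) → Prop
  | n {n : ℕ} (Q : QState n) :
      RootQ ⟨n, Q, .new⟩ {(1, ⟨n + 1, Q.snoc false, .reg n⟩)}
  | m {n : ℕ} (Q : QState (n + 1)) (a₀ a₁ : ℂ) (Q₀ Q₁ : QState n) (M N : Term G)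
      (h₀ : ‖Q₀‖ = 1) (h₁ : ‖Q₁‖ = 1)
      (hQ : Q = a₀ • Q₀.snoc false + a₁ • Q₁.snoc true) :
      RootQ ⟨n + 1, Q, .meas (.reg n) M N⟩
        (outcome (‖a₀‖ ^ 2) ⟨n, Q₀, M⟩ + outcome (‖a₁‖ ^ 2) ⟨n, Q₁, N⟩)
  | u1 {n : ℕ} (Q : QState (n + 1)) (A : G.Un) :
      RootQ ⟨n + 1, Q, .app (.gate1 A) (.reg 0)⟩
        {(1, ⟨n + 1, Q.apply1 (G.mat1 A : Matrix Bool Bool ℂ), .reg 0⟩)}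
  | u2 {n : ℕ} (Q : QState (n + 2)) (A : G.Bin) :
      RootQ ⟨n + 2, Q, .app (.gate2 A) (.pair (.reg 0) (.reg 1))⟩
        {(1, ⟨n + 2, Q.apply2 (G.mat2 A : Matrix (Bool × Bool) (Bool × Bool) ℂ),
          .pair (.reg 0) (.reg 1)⟩)}

/-- Closure of a root rule under the contexts that satisfy `ok`. -/
inductive Closure (ok : Ctx G → Prop) (root : Conf G → Multiset (ℝ × Conf G) → Prop) :
    Conf G → Multiset (ℝ × Conf G) → Prop
  | mk {n : ℕ} (C : Ctx G) (Q : QState n) (R : Term G) (m : Multiset (ℝ × Conf G))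
      (hC : ok C) (hR : root ⟨n, Q, R⟩ m) :
      Closure ok root ⟨n, Q, C.fill R⟩
        (m.map fun x => (x.1, ⟨x.2.size, x.2.state, C.fill x.2.term⟩))

/-- The relation between programs and multidistributions induced by a relation on
representatives. -/
def OnPrograms (r : Conf G → Multiset (ℝ × Conf G) → Prop) (e : Program G) (m : MDist G) : Prop :=
  ∃ (p : RawProgram G) (l : Multiset (ℝ × RawProgram G)),
    p.toProgram = e ∧ r p.toConf (l.map fun x => (x.1, x.2.toConf)) ∧
      m.1 = l.map fun x => (x.1, x.2.toProgram)

/-- `→_β`: β steps under arbitrary contexts. -/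
def BetaStep : Program G → MDist G → Prop := OnPrograms (Closure (fun _ => True) RootBeta)

/-- `→_{s β}`: β steps under surface contexts. -/
def SurfBetaStep : Program G → MDist G → Prop := OnPrograms (Closure Ctx.IsSurface RootBeta)

/-- `→_q`: quantum steps under surface contexts. -/
def QStep : Program G → MDist G → Prop := OnPrograms (Closure Ctx.IsSurface RootQ)

/-- `→`: general reduction steps. -/
def Step (e : Program G) (m : MDist G) : Prop := BetaStep e m ∨ QStep e m

/-- `→_s`: surface reduction steps. -/
def SurfStep (e : Program G) (m : MDist G) : Prop := SurfBetaStep e m ∨ QStep e m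

/-- Surface normal forms. -/
def SNF (e : Program G) : Prop := ¬ ∃ m, SurfStep e m

/-- Lifting of `r` to multidistributions: every weighted program `p e` of the source contributes
`p · n`, where either `r e n`, or `e` satisfies `stay` and `n = ⟦1 e⟧`. -/
def Lift (stay : Program G → Prop) (r : Program G → MDist G → Prop) (m m' : MDist G) : Prop :=
  ∃ l : Multiset (ℝ × Program G × MDist G),
    m.1 = l.map (fun x => (x.1, x.2.1)) ∧
      (∀ x ∈ l, (stay x.2.1 ∧ x.2.2 = MDist.dirac x.2.1) ∨ r x.2.1 x.2.2) ∧
      m'.1 = (l.map fun x => x.2.2.1.map fun y => (x.1 * y.1, y.2)).sum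

/-- `⇒`: the lifting of general reduction; any program may stay unchanged. -/
def Red : MDist G → MDist G → Prop := Lift (fun _ => True) Step

/-- The strict lifting of surface reduction; only surface normal forms stay unchanged. -/
def StrictSurfRed : MDist G → MDist G → Prop := Lift SNF SurfStep

/-- The probability that a multidistribution is in surface normal form. -/
noncomputable def MDist.prob (m : MDist G) : ℝ :=
  open Classical in (m.1.map fun x => if SNF x.2 then x.1 else 0).sum

/-- There is a `red`-sequence from `m` that converges with probability `p`. -/
def ConvergesTo (red : MDist G → MDist G → Prop) (m : MDist G) (p : ℝ) : Prop :=
  ∃ f : ℕ → MDist G, f 0 = m ∧ (∀ k, red (f k) (f (k + 1))) ∧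
    IsLUB (Set.range fun k => (f k).prob) p

end QLambda

namespace QLambda

universe u v

variable {G : GateSet.{u, v}}

namespace Term

/-! ### Renaming and substitution -/

/-! Each program has a probability of termination under surface reduction, `limValue`. Its
expectation over a multidistribution never increases along `Red` and bounds `prob` at every stage.
Along every `StrictSurfRed`-sequence, it equals the supremum of `prob`. Hence any strict surface
sequence from the initial multidistribution does at least as well as the given general sequence.

That all strict surface sequences agree is a quantitative form of the diamond property. A linear
abstraction has exactly one occurrence of its variable, a surface one, and no register occurs twice.
So two distinct surface steps close in one step on each side, and they act on disjoint sets of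
registers, whence their operators commute (`SStep.diamond`, `act_commute`). By induction on `n`, the
probability of being normal after `n` strict steps does not depend on the steps chosen
(`stepVal_eq`), and any surface step computes it (`value_succ`).

A β-step in an arbitrary context is an instance of the parallel reduction `Par`. A parallel
reduction factors into surface β-steps, which leave `limValue` unchanged, followed by a `Deep`
reduction, which acts only under `!` or in branches of `meas` (`Par.fact`). Deep reduction neither
creates nor destroys surface redexes, and a surface step that follows it can be done before it, at
the price of turning it into a parallel reduction (`Deep.step`, `Deep.step_forward`). This gives
`Par.value_le` by induction on the number of surface steps.

To avoid re-indexing and changes of dimension, these arguments use unnormalized states of countably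
many qubits, those not in use being `|0⟩`. Allocation becomes the identity, measurement resets its
qubit to `|0⟩`, and probabilities are squared norms. `Closure.sstep` and `RawProgram.SNF_iff` carry
the results back to programs. -/

theorem liftRen_comp (ρ τ : ℕ → ℕ) :
    (fun k => liftRen τ (liftRen ρ k)) = liftRen (fun k => τ (ρ k)) := by
  funext k; cases k <;> rfl

theorem rename_rename (ρ τ : ℕ → ℕ) (M : Term G) :
    rename τ (rename ρ M) = rename (fun k => τ (ρ k)) M := by
  induction M generalizing ρ τ <;> simp_all [rename, liftRen_comp]

theorem liftSub_liftRen (ρ : ℕ → ℕ) (s : ℕ → Term G) :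
    (fun k => liftSub s (liftRen ρ k)) = liftSub (fun k => s (ρ k)) := by
  funext k; cases k <;> rfl

theorem subst_rename (ρ : ℕ → ℕ) (s : ℕ → Term G) (M : Term G) :
    subst s (rename ρ M) = subst (fun k => s (ρ k)) M := by
  induction M generalizing ρ s <;> simp_all [rename, subst, liftSub_liftRen]

theorem rename_liftSub (τ : ℕ → ℕ) (s : ℕ → Term G) :
    (fun k => rename (liftRen τ) (liftSub s k)) = liftSub (fun k => rename τ (s k)) := by
  funext k
  cases k
  · rfl
  · simp [liftSub, rename_rename, liftRen]

theorem rename_subst (τ : ℕ → ℕ) (s : ℕ → Term G) (M : Term G) :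
    rename τ (subst s M) = subst (fun k => rename τ (s k)) M := by
  induction M generalizing τ s <;> simp_all [rename, subst, rename_liftSub]

theorem subst_liftSub (s t : ℕ → Term G) :
    (fun k => subst (liftSub t) (liftSub s k)) = liftSub (fun k => subst t (s k)) := by
  funext k
  cases k
  · rfl
  · simp [liftSub, subst_rename, rename_subst]

theorem subst_subst (s t : ℕ → Term G) (M : Term G) :
    subst t (subst s M) = subst (fun k => subst t (s k)) M := by
  induction M generalizing s t <;> simp_all [subst, subst_liftSub]

theorem liftSub_var : liftSub (var : ℕ → Term G) = var := by
  funext k; cases k <;> rfl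

theorem subst_var (M : Term G) : subst var M = M := by
  induction M <;> simp_all [subst, liftSub_var]

theorem liftSub_var_comp (ρ : ℕ → ℕ) :
    liftSub (fun k => (var (ρ k) : Term G)) = fun k => var (liftRen ρ k) := by
  funext k; cases k <;> rfl

theorem rename_eq_subst (ρ : ℕ → ℕ) (M : Term G) :
    rename ρ M = subst (fun k => var (ρ k)) M := by
  induction M generalizing ρ <;> simp_all [rename, subst, liftSub_var_comp]

/-- The substitution of `N` for the variable with index `0`. -/
def single (N : Term G) : ℕ → Term G
  | 0 => N
  | k + 1 => var k

theorem inst_eq (M N : Term G) : inst M N = subst (single N) M := by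
  unfold inst
  congr 1

theorem subst_inst (s : ℕ → Term G) (M N : Term G) :
    subst s (inst M N) = inst (subst (liftSub s) M) (subst s N) := by
  rw [inst_eq, inst_eq, subst_subst, subst_subst]
  congr 1
  funext k
  cases k
  · rfl
  · simp [single, liftSub, subst, subst_rename, subst_var]

theorem mapReg_rename (f : ℕ → ℕ) (ρ : ℕ → ℕ) (M : Term G) :
    mapReg f (rename ρ M) = rename ρ (mapReg f M) := by
  induction M generalizing ρ <;> simp_all [rename, mapReg]

theorem mapReg_liftSub (f : ℕ → ℕ) (s : ℕ → Term G) :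
    (fun k => mapReg f (liftSub s k)) = liftSub (fun k => mapReg f (s k)) := by
  funext k
  cases k <;> simp [liftSub, mapReg, mapReg_rename]

theorem mapReg_subst (f : ℕ → ℕ) (s : ℕ → Term G) (M : Term G) :
    mapReg f (subst s M) = subst (fun k => mapReg f (s k)) (mapReg f M) := by
  induction M generalizing s <;> simp_all [subst, mapReg, mapReg_liftSub]

theorem mapReg_inst (f : ℕ → ℕ) (M N : Term G) :
    mapReg f (inst M N) = inst (mapReg f M) (mapReg f N) := by
  rw [inst_eq, inst_eq, mapReg_subst]
  congr 1
  funext k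
  cases k <;> rfl

/-! ### Weighted counting of occurrences -/

/-- Extension of a weight of variables by a bound variable of weight `a`. -/
def consW (a : ℕ) (f : ℕ → ℕ) : ℕ → ℕ
  | 0 => a
  | k + 1 => f k

/-- The sum of the weights `f k` of the free occurrences of variables and `g i` of the occurrences
of registers; only surface occurrences are counted if `all` is `false`. -/
def cnt (all : Bool) : (ℕ → ℕ) → (ℕ → ℕ) → Term G → ℕ
  | f, _, var k => f k
  | f, g, bang M => if all then cnt all f g M else 0
  | f, g, lam M => cnt all (consW 0 f) g M
  | f, g, blam M => cnt all (consW 0 f) g M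
  | f, g, app M N => cnt all f g M + cnt all f g N
  | _, g, reg i => g i
  | _, _, gate1 _ => 0
  | _, _, gate2 _ => 0
  | _, _, new => 0
  | f, g, meas P M N => cnt all f g P + if all then cnt all f g M + cnt all f g N else 0

/-- The weight concentrated at `j`. -/
def unitW (j : ℕ) : ℕ → ℕ := fun i => if i = j then 1 else 0

theorem consW_unitW (j : ℕ) : consW 0 (unitW j) = unitW (j + 1) := by
  funext k; cases k <;> simp [consW, unitW]

theorem consW_zero : consW 0 0 = 0 := by
  funext k; cases k <;> rfl

/-- The four ways of counting, variables or registers and all or surface occurrences, are instances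
of `cnt`. The effect of substitution is thus analysed only once. -/
theorem cnt_unitW_true (j : ℕ) (M : Term G) : cnt true (unitW j) 0 M = varOcc j M := by
  induction M generalizing j <;> simp_all [cnt, varOcc, consW_unitW, add_assoc]
  simp [unitW]

theorem cnt_unitW_false (j : ℕ) (M : Term G) : cnt false (unitW j) 0 M = varSurfOcc j M := by
  induction M generalizing j <;> simp_all [cnt, varSurfOcc, consW_unitW]
  simp [unitW]

theorem cnt_reg_true (i : ℕ) (M : Term G) : cnt true 0 (unitW i) M = regOcc i M := by
  induction M <;> simp_all [cnt, regOcc, consW_zero, add_assoc]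
  simp [unitW]

theorem cnt_reg_false (i : ℕ) (M : Term G) : cnt false 0 (unitW i) M = regSurfOcc i M := by
  induction M <;> simp_all [cnt, regSurfOcc, consW_zero]
  simp [unitW]

theorem cnt_le (f g : ℕ → ℕ) (M : Term G) : cnt false f g M ≤ cnt true f g M := by
  induction M generalizing f <;> simp_all [cnt]
  · gcongr <;> simp_all
  · rename_i h _ _
    have := h f
    omega

theorem consW_liftRen (a : ℕ) (f ρ : ℕ → ℕ) :
    (fun k => consW a f (liftRen ρ k)) = consW a (fun k => f (ρ k)) := by
  funext k; cases k <;> rfl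

theorem cnt_rename (all : Bool) (f g : ℕ → ℕ) (ρ : ℕ → ℕ) (M : Term G) :
    cnt all f g (rename ρ M) = cnt all (fun k => f (ρ k)) g M := by
  cases all <;> induction M generalizing f ρ <;> simp_all [cnt, rename, consW_liftRen]

theorem cnt_liftSub (all : Bool) (f g : ℕ → ℕ) (s : ℕ → Term G) :
    (fun k => cnt all (consW 0 f) g (liftSub s k)) = consW 0 (fun k => cnt all f g (s k)) := by
  funext k
  cases k <;> simp [liftSub, cnt, consW, cnt_rename]

theorem cnt_subst (all : Bool) (f g : ℕ → ℕ) (s : ℕ → Term G) (M : Term G) :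
    cnt all f g (subst s M) = cnt all (fun k => cnt all f g (s k)) g M := by
  cases all <;> induction M generalizing f s <;> simp_all [cnt, subst, cnt_liftSub]

/-- Counting is affine in the weight of a single variable. With `j = 0` and `a` the count of `N`,
this gives the count of `inst M N`; a general `j` is needed to pass under binders. -/
theorem cnt_consW (all : Bool) (a : ℕ) (f g : ℕ → ℕ) (j : ℕ) (h : ℕ → ℕ)
    (hf : ∀ k, h k = f k + a * unitW j k) (M : Term G) :
    cnt all h g M = cnt all f g M + a * cnt all (unitW j) 0 M := by
  induction M generalizing f h j with
  | var k => simp [cnt, hf]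
  | bang M ih => cases all <;> simp [cnt, ih f j h hf]
  | lam M ih =>
    rw [cnt, cnt, cnt, consW_unitW]
    exact ih _ _ _ fun k => by cases k <;> simp [consW, hf, unitW]
  | blam M ih =>
    rw [cnt, cnt, cnt, consW_unitW]
    exact ih _ _ _ fun k => by cases k <;> simp [consW, hf, unitW]
  | app M N ihM ihN => simp only [cnt, ihM f j h hf, ihN f j h hf]; ring
  | reg i => simp [cnt]
  | gate1 A => simp [cnt]
  | gate2 A => simp [cnt]
  | new => simp [cnt]
  | meas P M N ihP ihM ihN =>
    simp only [cnt, ihP f j h hf, ihM f j h hf, ihN f j h hf]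
    split_ifs <;> ring

theorem cnt_inst (all : Bool) (f g : ℕ → ℕ) (M N : Term G) :
    cnt all f g (inst M N) =
      cnt all (consW 0 f) g M + cnt all f g N * cnt all (unitW 0) 0 M := by
  rw [inst_eq, cnt_subst]
  apply cnt_consW
  intro k
  cases k <;> simp [single, consW, unitW, cnt]

/-! ### Linearity of abstractions under substitution -/

theorem cnt_zero (all : Bool) (M : Term G) : cnt all 0 0 M = 0 := by
  cases all <;> induction M <;> simp_all [cnt, consW_zero]

/-- The terms substituted under a binder are shifted, so they do not contain its variable. This is
why substitution preserves linearity of abstractions. -/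
theorem cnt_unitW_liftSub (all : Bool) (s : ℕ → Term G) (M : Term G) :
    cnt all (unitW 0) 0 (subst (liftSub s) M) = cnt all (unitW 0) 0 M := by
  rw [cnt_subst]
  congr 1
  funext k
  cases k
  · rfl
  · simp only [liftSub, cnt_rename]
    exact cnt_zero all _

theorem cnt_unitW_liftRen (all : Bool) (ρ : ℕ → ℕ) (M : Term G) :
    cnt all (unitW 0) 0 (rename (liftRen ρ) M) = cnt all (unitW 0) 0 M := by
  rw [cnt_rename]
  congr 1
  funext k
  cases k <;> simp [liftRen, unitW]

theorem LinearLams.rename {M : Term G} (h : LinearLams M) (ρ : ℕ → ℕ) :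
    LinearLams (rename ρ M) := by
  induction M generalizing ρ with
  | lam M ih =>
    simp only [LinearLams, ← cnt_unitW_true, ← cnt_unitW_false, Term.rename,
      cnt_unitW_liftRen] at h ⊢
    exact ⟨h.1, h.2.1, ih h.2.2 _⟩
  | _ => simp_all [LinearLams, Term.rename]

theorem LinearLams.subst {M : Term G} (h : LinearLams M) {s : ℕ → Term G}
    (hs : ∀ k, LinearLams (s k)) : LinearLams (subst s M) := by
  have lift {s : ℕ → Term G} (hs : ∀ k, LinearLams (s k)) : ∀ k, LinearLams (liftSub s k) := by
    intro k
    cases k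
    · trivial
    · exact (hs _).rename _
  induction M generalizing s with
  | lam M ih =>
    simp only [LinearLams, ← cnt_unitW_true, ← cnt_unitW_false, Term.subst,
      cnt_unitW_liftSub] at h ⊢
    exact ⟨h.1, h.2.1, ih h.2.2 (lift hs)⟩
  | blam M ih => exact ih h (lift hs)
  | _ => simp_all [LinearLams, Term.subst]

theorem LinearLams.inst {M N : Term G} (hM : LinearLams M) (hN : LinearLams N) :
    LinearLams (inst M N) := by
  rw [inst_eq]
  refine hM.subst fun k => ?_
  cases k
  · exact hN
  · trivial

end Term

/-! ### Labelled surface steps -/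

/-- Kinds of surface steps, with the registers that they act on. -/
inductive Lbl (G : GateSet.{u, v}) : Type (max u v)
  | beta
  | new
  | meas (i : ℕ)
  | u1 (A : G.Un) (i : ℕ)
  | u2 (A : G.Bin) (i j : ℕ)

open Term in
/-- Surface steps of terms. The reduct depends on the name of a new register and on the outcome
of a measurement. -/
inductive SStep : Term G → Lbl G → (ℕ → Bool → Term G) → Prop
  | beta (M N : Term G) : SStep (app (lam M) N) .beta fun _ _ => inst M N
  | bbeta (M N : Term G) : SStep (app (blam M) (bang N)) .beta fun _ _ => inst M N
  | new : SStep new .new fun k _ => reg k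
  | meas (i : ℕ) (M N : Term G) : SStep (meas (reg i) M N) (.meas i) fun _ b => cond b N M
  | u1 (A : G.Un) (i : ℕ) : SStep (app (gate1 A) (reg i)) (.u1 A i) fun _ _ => reg i
  | u2 (A : G.Bin) (i j : ℕ) :
      SStep (app (gate2 A) (lam (app (app (var 0) (reg i)) (reg j)))) (.u2 A i j)
        fun _ _ => lam (app (app (var 0) (reg i)) (reg j))
  | appL {M : Term G} {l T} (N : Term G) (h : SStep M l T) :
      SStep (app M N) l fun k b => app (T k b) N
  | appR {N : Term G} {l T} (M : Term G) (h : SStep N l T) :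
      SStep (app M N) l fun k b => app M (T k b)
  | lam {M : Term G} {l T} (h : SStep M l T) : SStep (lam M) l fun k b => lam (T k b)
  | blam {M : Term G} {l T} (h : SStep M l T) : SStep (blam M) l fun k b => blam (T k b)
  | measS {P : Term G} {l T} (M N : Term G) (h : SStep P l T) :
      SStep (meas P M N) l fun k b => meas (T k b) M N

namespace Lbl

/-- The registers a step acts on. -/
def regs : Lbl G → Finset ℕ
  | beta => ∅
  | new => ∅
  | meas i => {i}
  | u1 _ i => {i}
  | u2 _ i j => {i, j}

/-- The weight of the register that a step consumes. -/
def loss (g : ℕ → ℕ) : Lbl G → ℕ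
  | meas i => g i
  | _ => 0

/-- The weight of the register that a step creates. -/
def gain (g : ℕ → ℕ) (k : ℕ) : Lbl G → ℕ
  | new => g k
  | _ => 0

/-- Renaming of the registers of a label. -/
def map (f : ℕ → ℕ) : Lbl G → Lbl G
  | beta => beta
  | new => new
  | meas i => meas (f i)
  | u1 A i => u1 A (f i)
  | u2 A i j => u2 A (f i) (f j)

end Lbl

namespace SStep

open Term

/-! ### Surface steps under substitution and renaming of registers -/

theorem subst {M : Term G} {l : Lbl G} {T} (h : SStep M l T) (s : ℕ → Term G) :
    SStep (subst s M) l fun k b => subst s (T k b) := by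
  induction h generalizing s with
  | beta M N => simp only [subst_inst]; exact .beta _ _
  | bbeta M N => simp only [subst_inst]; exact .bbeta _ _
  | new => exact .new
  | meas i M N =>
    simp only [Bool.apply_cond (Term.subst s)]
    exact .meas i _ _
  | u1 A i => exact .u1 A i
  | u2 A i j => exact .u2 A i j
  | appL N h ih => exact .appL _ (ih s)
  | appR M h ih => exact .appR _ (ih s)
  | lam h ih => exact .lam (ih _)
  | blam h ih => exact .blam (ih _)
  | measS M N h ih => exact .measS _ _ (ih s)

theorem rename {M : Term G} {l : Lbl G} {T} (h : SStep M l T) (ρ : ℕ → ℕ) :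
    SStep (rename ρ M) l fun k b => rename ρ (T k b) := by
  simp only [rename_eq_subst]
  exact h.subst _

theorem subst_congr_of_varOcc {M : Term G} {s t : ℕ → Term G} {j : ℕ} (hM : varOcc j M = 0)
    (hst : ∀ k, k ≠ j → s k = t k) : Term.subst s M = Term.subst t M := by
  have lift {s t : ℕ → Term G} {j : ℕ} (hst : ∀ k, k ≠ j → s k = t k) :
      ∀ k, k ≠ j + 1 → liftSub s k = liftSub t k := by
    intro k hk
    cases k with
    | zero => rfl
    | succ k => simp [liftSub, hst k (by omega)]
  induction M generalizing s t j with
  | var k => exact hst k fun h => by simp [varOcc, h] at hM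
  | lam M ih => exact congrArg Term.lam (ih hM (lift hst))
  | blam M ih => exact congrArg Term.blam (ih hM (lift hst))
  | bang M ih => exact congrArg Term.bang (ih hM hst)
  | app M N ihM ihN =>
    simp only [varOcc, Nat.add_eq_zero_iff] at hM
    simp only [Term.subst, ihM hM.1 hst, ihN hM.2 hst]
  | meas P M N ihP ihM ihN =>
    simp only [varOcc, Nat.add_eq_zero_iff] at hM
    simp only [Term.subst, ihP hM.1.1 hst, ihM hM.1.2 hst, ihN hM.2 hst]
  | _ => rfl

theorem varSurfOcc_le (j : ℕ) (M : Term G) : varSurfOcc j M ≤ varOcc j M := by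
  rw [← cnt_unitW_true, ← cnt_unitW_false]; exact cnt_le _ _ _

/-- A step of the term substituted for a linear variable. -/
theorem subst_linear {M : Term G} {l : Lbl G} {j : ℕ} {s : ℕ → Term G}
    {t : ℕ → Bool → ℕ → Term G} (hM : varOcc j M = 1) (hM' : varSurfOcc j M = 1)
    (hst : ∀ k b i, i ≠ j → s i = t k b i) (h : SStep (s j) l fun k b => t k b j) :
    SStep (Term.subst s M) l fun k b => Term.subst (t k b) M := by
  have lift {j : ℕ} {s : ℕ → Term G} {t : ℕ → Bool → ℕ → Term G}
      (hst : ∀ k b i, i ≠ j → s i = t k b i) :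
      ∀ k b i, i ≠ j + 1 → liftSub s i = liftSub (t k b) i := by
    intro k b i hi
    cases i with
    | zero => rfl
    | succ i => simp [liftSub, hst k b i (by omega)]
  induction M generalizing j s t with
  | var k =>
    have : k = j := by by_contra h; simp [varOcc, h] at hM
    subst this
    exact h
  | lam M ih => exact .lam (ih hM hM' (lift hst) (h.rename Nat.succ))
  | blam M ih => exact .blam (ih hM hM' (lift hst) (h.rename Nat.succ))
  | app M N ihM ihN =>
    simp only [varOcc, varSurfOcc] at hM hM'
    have h1 := varSurfOcc_le j M
    have h2 := varSurfOcc_le j N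
    -- The only occurrence of `j` is a surface one, so it lies in exactly one of the two components,
    -- and the other component is unaffected by the step.
    rcases Nat.eq_zero_or_pos (varSurfOcc j M) with h0 | h0
    · have e (k b) : Term.subst (t k b) M = Term.subst s M :=
        subst_congr_of_varOcc (M := M) (j := j) (by omega) fun i hi => (hst k b i hi).symm
      simp only [Term.subst, e]
      exact .appR _ (ihN (by omega) (by omega) hst h)
    · have e (k b) : Term.subst (t k b) N = Term.subst s N :=
        subst_congr_of_varOcc (M := N) (j := j) (by omega) fun i hi => (hst k b i hi).symm
      simp only [Term.subst, e]
      exact .appL _ (ihM (by omega) (by omega) hst h)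
  | meas P M N ihP ihM ihN =>
    simp only [varOcc, varSurfOcc] at hM hM'
    have h1 := varSurfOcc_le j P
    have e (k b) : Term.subst (t k b) M = Term.subst s M :=
      subst_congr_of_varOcc (M := M) (j := j) (by omega) fun i hi => (hst k b i hi).symm
    have e' (k b) : Term.subst (t k b) N = Term.subst s N :=
      subst_congr_of_varOcc (M := N) (j := j) (by omega) fun i hi => (hst k b i hi).symm
    simp only [Term.subst, e, e']
    exact .measS _ _ (ihP (by omega) (by omega) hst h)
  | _ => simp [varSurfOcc] at hM'

theorem inst_linear {M N : Term G} {l : Lbl G} {T} (hM : varOcc 0 M = 1)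
    (hM' : varSurfOcc 0 M = 1) (h : SStep N l T) :
    SStep (inst M N) l fun k b => inst M (T k b) := by
  simp only [inst_eq]
  refine subst_linear (j := 0) (t := fun k b => single (T k b)) hM hM' ?_ h
  intro k b i hi
  cases i
  · exact absurd rfl hi
  · rfl

/-- Renaming of registers along a permutation. -/
theorem mapReg {M : Term G} {l : Lbl G} {T} (h : SStep M l T) (π : Equiv.Perm ℕ) :
    SStep (mapReg π M) (l.map π) fun k b => mapReg π (T (π.symm k) b) := by
  induction h with
  | beta M N => simp only [mapReg_inst]; exact .beta _ _
  | bbeta M N => simp only [mapReg_inst]; exact .bbeta _ _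
  | new => simpa [Term.mapReg, Lbl.map] using SStep.new
  | meas i M N =>
    simp only [Bool.apply_cond (Term.mapReg π)]
    exact .meas (π i) _ _
  | u1 A i => exact .u1 A _
  | u2 A i j => exact .u2 A _ _
  | appL N h ih => exact .appL _ ih
  | appR M h ih => exact .appR _ ih
  | lam h ih => exact .lam ih
  | blam h ih => exact .blam ih
  | measS M N h ih => exact .measS _ _ ih

theorem mapReg_of_fix {M : Term G} {f : ℕ → ℕ} (hf : ∀ i, 0 < regOcc i M → f i = i) :
    Term.mapReg f M = M := by
  induction M with
  | reg i => simp [Term.mapReg, hf i (by simp [regOcc])]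
  | app M N ihM ihN =>
    simp only [regOcc] at hf
    simp only [Term.mapReg, ihM fun i hi => hf i (by omega), ihN fun i hi => hf i (by omega)]
  | meas P M N ihP ihM ihN =>
    simp only [regOcc] at hf
    simp only [Term.mapReg, ihM fun i hi => hf i (by omega), ihN fun i hi => hf i (by omega),
      ihP fun i hi => hf i (by omega)]
  | bang M ih => simp only [Term.mapReg, ih hf]
  | lam M ih => simp only [Term.mapReg, ih hf]
  | blam M ih => simp only [Term.mapReg, ih hf]
  | _ => rfl

/-- The reduct depends naturally on the name of the new register. -/
theorem mapReg_reduct {M : Term G} {l : Lbl G} {T} (h : SStep M l T) {f : ℕ → ℕ}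
    (hf : ∀ i, 0 < regOcc i M → f i = i) (k : ℕ) (b : Bool) :
    Term.mapReg f (T k b) = T (f k) b := by
  induction h with
  | beta M N =>
    simp only [regOcc] at hf
    rw [mapReg_inst, mapReg_of_fix fun i hi => hf i (by omega),
      mapReg_of_fix fun i hi => hf i (by omega)]
  | bbeta M N =>
    simp only [regOcc] at hf
    rw [mapReg_inst, mapReg_of_fix fun i hi => hf i (by omega),
      mapReg_of_fix fun i hi => hf i (by omega)]
  | new => rfl
  | meas i M N =>
    simp only [regOcc] at hf
    cases b
    · exact mapReg_of_fix (M := M) fun i hi => hf i (by omega)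
    · exact mapReg_of_fix (M := N) fun i hi => hf i (by omega)
  | u1 A i => exact mapReg_of_fix fun i hi => hf i (by simpa [regOcc] using hi)
  | u2 A i j => exact mapReg_of_fix fun i hi => hf i (by simpa [regOcc] using hi)
  | appL N h ih =>
    simp only [regOcc] at hf
    simp only [Term.mapReg, ih fun i hi => hf i (by omega),
      mapReg_of_fix (M := N) fun i hi => hf i (by omega)]
  | appR M h ih =>
    simp only [regOcc] at hf
    simp only [Term.mapReg, ih fun i hi => hf i (by omega),
      mapReg_of_fix (M := M) fun i hi => hf i (by omega)]
  | lam h ih => simp only [Term.mapReg, ih hf]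
  | blam h ih => simp only [Term.mapReg, ih hf]
  | measS M N h ih =>
    simp only [regOcc] at hf
    simp only [Term.mapReg, ih fun i hi => hf i (by omega),
      mapReg_of_fix (M := M) fun i hi => hf i (by omega),
      mapReg_of_fix (M := N) fun i hi => hf i (by omega)]

/-! ### Preservation of validity -/

/-- The hypothesis `hc` says that nothing under `!` or in a branch carries weight. Duplicating or
erasing the argument of `λ!`, or dropping a branch, therefore costs nothing, while a linear argument
is copied exactly once. Unit weights on variables give preservation of linearity, and unit weights
on registers give the bookkeeping of registers. -/
theorem cnt_reduct {M : Term G} {l : Lbl G} {T} (h : SStep M l T) (hM : LinearLams M)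
    (f g : ℕ → ℕ) (hc : cnt false f g M = cnt true f g M) (k : ℕ) (b : Bool) :
    cnt true f g (T k b) + l.loss g = cnt true f g M + l.gain g k ∧
      cnt false f g (T k b) = cnt true f g (T k b) := by
  induction h generalizing f with
  | beta M N =>
    obtain ⟨⟨h1, h2, -⟩, -⟩ := hM
    rw [← cnt_unitW_true] at h1
    rw [← cnt_unitW_false] at h2
    have e1 := cnt_le (consW 0 f) g M
    have e2 := cnt_le f g N
    simp only [cnt, cnt_inst, h1, h2, Lbl.loss, Lbl.gain] at hc ⊢
    omega
  | bbeta M N =>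
    have e1 := cnt_le (consW 0 f) g M
    simp only [cnt, if_true, Bool.false_eq_true, if_false] at hc
    have e2 : cnt true f g N = 0 := by omega
    have e3 := cnt_le f g N
    have e4 : cnt false f g N = 0 := by omega
    simp only [cnt, cnt_inst, e2, e4, Lbl.loss, Lbl.gain, if_true, zero_mul]
    omega
  | new => simp [cnt, Lbl.loss, Lbl.gain]
  | meas i M N =>
    simp only [cnt, if_true, Bool.false_eq_true, if_false] at hc
    have e1 := cnt_le f g M
    have e2 := cnt_le f g N
    cases b <;> simp only [cnt, Lbl.loss, Lbl.gain, if_true, cond_true, cond_false] <;> omega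
  | u1 A i => simp [cnt, Lbl.loss, Lbl.gain]
  | u2 A i j => simp [cnt, Lbl.loss, Lbl.gain]
  | @appL M _ _ N h ih =>
    simp only [cnt] at hc
    have e1 := cnt_le f g M
    have e2 := cnt_le f g N
    have := ih hM.1 f (by omega)
    simp only [cnt]
    omega
  | @appR N _ _ M h ih =>
    simp only [cnt] at hc
    have e1 := cnt_le f g M
    have e2 := cnt_le f g N
    have := ih hM.2 f (by omega)
    simp only [cnt]
    omega
  | lam h ih => exact ih hM.2.2 _ hc
  | blam h ih => exact ih hM _ hc
  | @measS P _ _ M N h ih =>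
    simp only [cnt, if_true, Bool.false_eq_true, if_false] at hc
    have e1 := cnt_le f g P
    have := ih hM.1 f (by omega)
    simp only [cnt, if_true, Bool.false_eq_true, if_false]
    omega

theorem linearLams {M : Term G} {l : Lbl G} {T} (h : SStep M l T) (hM : LinearLams M) (k : ℕ)
    (b : Bool) : LinearLams (T k b) := by
  induction h with
  | beta M N => exact hM.1.2.2.inst hM.2
  | bbeta M N => exact LinearLams.inst (M := M) (N := N) hM.1 hM.2
  | new => trivial
  | meas i M N => cases b; exacts [hM.2.1, hM.2.2]
  | u1 A i => trivial
  | u2 A i j => exact hM.2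
  | appL N h ih => exact ⟨ih hM.1, hM.2⟩
  | appR M h ih => exact ⟨hM.1, ih hM.2⟩
  | lam h ih =>
    obtain ⟨h1, h2, h3⟩ := hM
    rw [← cnt_unitW_true] at h1
    rw [← cnt_unitW_false] at h2
    have := h.cnt_reduct h3 (unitW 0) 0 (by omega) k b
    have e (l : Lbl G) : l.loss 0 = 0 ∧ l.gain 0 k = 0 := by cases l <;> exact ⟨rfl, rfl⟩
    rw [(e _).1, (e _).2] at this
    refine ⟨?_, ?_, ih h3⟩
    · rw [← cnt_unitW_true]; omega
    · rw [← cnt_unitW_false]; omega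
  | blam h ih => exact ih hM
  | measS M N h ih => exact ⟨ih hM.1, hM.2⟩

theorem regOcc_reduct {M : Term G} {l : Lbl G} {T} (h : SStep M l T) (hM : Valid M) (k : ℕ)
    (b : Bool) (i : ℕ) :
    regOcc i (T k b) + l.loss (unitW i) = regOcc i M + l.gain (unitW i) k := by
  have := (h.cnt_reduct hM.2 0 (unitW i)
    (by rw [cnt_reg_true, cnt_reg_false]; exact (hM.1 i).2) k b).1
  rwa [cnt_reg_true, cnt_reg_true] at this

theorem valid {M : Term G} {l : Lbl G} {T} (h : SStep M l T) (hM : Valid M) {k : ℕ}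
    (hk : regOcc k M = 0) (b : Bool) : Valid (T k b) := by
  refine ⟨fun i => ⟨?_, ?_⟩, h.linearLams hM.2 k b⟩
  · have h1 := h.regOcc_reduct hM k b i
    have h2 := (hM.1 i).1
    have h3 : l.gain (unitW i) k ≤ 1 ∧ (l.gain (unitW i) k ≠ 0 → k = i) := by
      cases l <;> simp [Lbl.gain, unitW]; split_ifs <;> simp
    by_cases h4 : l.gain (unitW i) k = 0
    · omega
    · have := h3.2 h4
      subst this
      omega
  · have := (h.cnt_reduct hM.2 0 (unitW i)
      (by rw [cnt_reg_true, cnt_reg_false]; exact (hM.1 i).2) k b).2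
    rwa [cnt_reg_true, cnt_reg_false] at this

theorem regSurfOcc_pos {M : Term G} {l : Lbl G} {T} (h : SStep M l T) {i : ℕ} (hi : i ∈ l.regs) :
    0 < regSurfOcc i M := by
  induction h with
  | u2 A j k =>
    rcases Finset.mem_insert.mp hi with rfl | hi
    · simp [regSurfOcc]
    · simp [regSurfOcc, Finset.mem_singleton.mp hi]
  | _ => simp_all [Lbl.regs, regSurfOcc]

theorem regSurfOcc_le (i : ℕ) (M : Term G) : regSurfOcc i M ≤ regOcc i M := by
  rw [← cnt_reg_true, ← cnt_reg_false]; exact cnt_le _ _ _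

end SStep

open scoped ENNReal

/-! ### Unnormalized states of countably many qubits -/

/-- Unnormalized states of countably many qubits, given by their coordinates. -/
abbrev St : Type := (ℕ → Bool) → ℂ

namespace St

/-- The squared norm. -/
noncomputable def nsq (Q : St) : ℝ≥0∞ := ∑' c, ‖Q c‖ₑ ^ 2

/-- The operator `|b⟩⟨d|` acting on qubit `i`. -/
noncomputable def E (i : ℕ) (b d : Bool) : Module.End ℂ St where
  toFun Q c := if c i = b then Q (Function.update c i d) else 0
  map_add' Q R := by funext c; simp only [Pi.add_apply]; split_ifs <;> simp
  map_smul' a Q := by funext c; simp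

theorem E_apply (i : ℕ) (b d : Bool) (Q : St) (c : ℕ → Bool) :
    E i b d Q c = if c i = b then Q (Function.update c i d) else 0 := rfl

theorem E_commute {i j : ℕ} (h : i ≠ j) (b d b' d' : Bool) : Commute (E i b d) (E j b' d') := by
  ext Q c
  simp only [Module.End.mul_apply, E_apply, Function.update_of_ne h,
    Function.update_of_ne h.symm, Function.update_comm h]
  split_ifs <;> rfl

/-- The states all of whose components have qubit `i` equal to `|0⟩`. -/
def van (i : ℕ) : Submodule ℂ St where
  carrier := {Q | ∀ c, c i = true → Q c = 0}
  add_mem' hQ hR c hc := by simp [hQ c hc, hR c hc]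
  zero_mem' c _ := rfl
  smul_mem' a Q hQ c hc := by simp [hQ c hc]

theorem E_mem_van {i j : ℕ} (h : j ≠ i) (b d : Bool) {Q : St} (hQ : Q ∈ van j) :
    E i b d Q ∈ van j := by
  intro c hc
  rw [E_apply, hQ _ (by rwa [Function.update_of_ne h]), ite_self]

theorem E_false_mem_van (i : ℕ) (d : Bool) (Q : St) : E i false d Q ∈ van i := by
  intro c hc
  simp [E_apply, hc]

/-- Renaming of the qubits. -/
def perm (π : Equiv.Perm ℕ) : Module.End ℂ St := LinearMap.funLeft ℂ ℂ fun c i => c (π i)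

theorem perm_apply (π : Equiv.Perm ℕ) (Q : St) (c : ℕ → Bool) :
    perm π Q c = Q fun i => c (π i) := rfl

theorem perm_symm_perm (π : Equiv.Perm ℕ) (Q : St) : perm π.symm (perm π Q) = Q := by
  funext c
  simp [perm_apply]

theorem E_perm (π : Equiv.Perm ℕ) (i : ℕ) (b d : Bool) :
    E (π i) b d * perm π = perm π * E i b d := by
  ext Q c
  simp only [Module.End.mul_apply, E_apply, perm_apply]
  congr 2
  exact Function.update_comp_eq_of_injective c π.injective i d

theorem nsq_perm (π : Equiv.Perm ℕ) (Q : St) : nsq (perm π Q) = nsq Q :=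
  (π.symm.arrowCongr (Equiv.refl Bool)).tsum_eq fun c => ‖Q c‖ₑ ^ 2

theorem nsq_smul (a : ℂ) (Q : St) : nsq (a • Q) = ‖a‖ₑ ^ 2 * nsq Q := by
  simp [nsq, enorm_mul, mul_pow, ENNReal.tsum_mul_left]

/-- A state all of whose qubits `i` and `j` are `|0⟩` is symmetric in `i` and `j`. -/
theorem perm_swap {i j : ℕ} {Q : St} (hi : Q ∈ van i) (hj : Q ∈ van j) :
    perm (Equiv.swap i j) Q = Q := by
  funext c
  rw [perm_apply]
  by_cases h1 : c i = true
  · rw [hi c h1, hj _ (by simpa using h1)]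
  · by_cases h2 : c j = true
    · rw [hj c h2, hi _ (by simpa using h2)]
    · congr 1
      funext k
      rcases eq_or_ne k i with rfl | hki
      · simp_all
      · rcases eq_or_ne k j with rfl | hkj
        · simp_all
        · rw [Equiv.swap_apply_of_ne_of_ne hki hkj]

end St

open St

/-- The action of a step on states, for a given outcome. The outcome of a deterministic step
is `true`. -/
noncomputable def act : Lbl G → Bool → Module.End ℂ St
  | .beta, b => if b then 1 else 0
  -- A fresh register names a qubit that is already `|0⟩`.
  | .new, b => if b then 1 else 0
  -- The measured qubit is reset to `|0⟩` instead of being discarded, which makes its name fresh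
  -- again; the result is not normalized.
  | .meas i, b => E i false b
  | .u1 A i, b => if b then
      ∑ x : Bool, ∑ y : Bool, (G.mat1 A : Matrix Bool Bool ℂ) x y • E i x y else 0
  | .u2 A i j, b => if b then
      ∑ x : Bool × Bool, ∑ y : Bool × Bool,
        (G.mat2 A : Matrix (Bool × Bool) (Bool × Bool) ℂ) x y • (E i x.1 y.1 * E j x.2 y.2)
      else 0

/-- Unless it is `0` or `1`, the action is a linear combination of products of operators `E` on the
registers of the label. -/
theorem commute_act_of_commute_E {X : Module.End ℂ St} {l : Lbl G}
    (h : ∀ i ∈ l.regs, ∀ b d, Commute X (E i b d)) (b : Bool) : Commute X (act l b) := by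
  cases l <;> simp only [act] <;> (try split_ifs) <;>
    first
    | exact Commute.one_right _
    | exact Commute.zero_right _
    | skip
  · exact h _ (by simp [Lbl.regs]) _ _
  · refine Commute.sum_right _ _ _ fun x _ => Commute.sum_right _ _ _ fun y _ => ?_
    exact (h _ (by simp [Lbl.regs]) _ _).smul_right _
  · refine Commute.sum_right _ _ _ fun x _ => Commute.sum_right _ _ _ fun y _ => ?_
    exact ((h _ (by simp [Lbl.regs]) _ _).mul_right (h _ (by simp [Lbl.regs]) _ _)).smul_right _

theorem act_commute {l l' : Lbl G} (h : Disjoint l.regs l'.regs) (b b' : Bool) :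
    Commute (act l b) (act l' b') := by
  refine commute_act_of_commute_E (fun i hi x y => ?_) b'
  refine (commute_act_of_commute_E (fun j hj x' y' => ?_) b).symm
  refine E_commute ?_ _ _ _ _
  rintro rfl
  exact Finset.disjoint_left.mp h hj hi

theorem act_mem_van {l : Lbl G} {j : ℕ} (hj : j ∉ l.regs) {Q : St} (hQ : Q ∈ van j) (b : Bool) :
    act l b Q ∈ van j := by
  cases l <;> simp only [act] <;> (try split_ifs) <;>
    first
    | exact hQ
    | exact Submodule.zero_mem _
    | skip
  · exact E_mem_van (by simpa [Lbl.regs] using hj) _ _ hQ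
  · simp only [LinearMap.sum_apply]
    refine Submodule.sum_mem _ fun x _ => Submodule.sum_mem _ fun y _ => ?_
    exact Submodule.smul_mem _ _ (E_mem_van (by simpa [Lbl.regs] using hj) _ _ hQ)
  · simp only [LinearMap.sum_apply]
    simp only [Lbl.regs, Finset.mem_insert, Finset.mem_singleton, not_or] at hj
    refine Submodule.sum_mem _ fun x _ => Submodule.sum_mem _ fun y _ => ?_
    exact Submodule.smul_mem _ _ (E_mem_van hj.1 _ _ (E_mem_van hj.2 _ _ hQ))

theorem act_perm (π : Equiv.Perm ℕ) (l : Lbl G) (b : Bool) :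
    act (l.map π) b * perm π = perm π * act l b := by
  cases l <;> simp only [act, Lbl.map] <;> (try split_ifs) <;>
    first
    | simp only [one_mul, mul_one, zero_mul, mul_zero]
    | skip
  · exact E_perm _ _ _ _
  · simp only [Finset.sum_mul, Finset.mul_sum, smul_mul_assoc, mul_smul_comm, E_perm]
  · simp only [Finset.sum_mul, Finset.mul_sum, smul_mul_assoc, mul_smul_comm]
    refine Finset.sum_congr rfl fun x _ => Finset.sum_congr rfl fun y _ => ?_
    rw [mul_assoc, E_perm, ← mul_assoc, E_perm, mul_assoc]

/-! ### The diamond property of surface steps -/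

open Term

/-- Two distinct steps with these labels and reducts commute. -/
def Close (l l' : Lbl G) (T T' : ℕ → Bool → Term G) : Prop :=
  Disjoint l.regs l'.regs ∧ ∃ U : ℕ → Bool → ℕ → Bool → Term G,
    (∀ k b, SStep (T k b) l' (U k b)) ∧ ∀ k' b', SStep (T' k' b') l fun k b => U k b k' b'

namespace Close

theorem symm {l l' : Lbl G} {T T'} (h : Close l l' T T') : Close l' l T' T := by
  obtain ⟨hd, U, h1, h2⟩ := h
  exact ⟨hd.symm, fun k b k' b' => U k' b' k b, h2, h1⟩

theorem map {l l' : Lbl G} {T T'} (h : Close l l' T T') (F : Term G → Term G)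
    (hF : ∀ {M l T}, SStep M l T → SStep (F M) l fun k b => F (T k b)) :
    Close l l' (fun k b => F (T k b)) (fun k b => F (T' k b)) := by
  obtain ⟨hd, U, h1, h2⟩ := h
  exact ⟨hd, fun k b k' b' => F (U k b k' b'), fun k b => hF (h1 k b), fun k b => hF (h2 k b)⟩

end Close

theorem SStep.close_app {M N : Term G} {l l' : Lbl G} {T T'} (h : SStep M l T) (h' : SStep N l' T')
    (hr : ∀ i, regSurfOcc i (app M N) ≤ 1) :
    Close l l' (fun k b => app (T k b) N) (fun k b => app M (T' k b)) := by
  refine ⟨Finset.disjoint_left.mpr fun i hi hi' => ?_,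
    fun k b k' b' => app (T k b) (T' k' b'), fun k b => .appR _ h', fun k b => .appL _ h⟩
  have h1 := h.regSurfOcc_pos hi
  have h2 := h'.regSurfOcc_pos hi'
  have := hr i
  simp only [regSurfOcc] at this
  omega

theorem SStep.close_beta_left {M N : Term G} {l : Lbl G} {T} (h : SStep M l T) :
    Close .beta l (fun _ _ => inst M N) (fun k b => app (Term.lam (T k b)) N) := by
  refine ⟨Finset.disjoint_empty_left _, fun _ _ k b => inst (T k b) N, fun _ _ => ?_,
    fun k b => .beta _ _⟩
  simp only [inst_eq]
  exact h.subst _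

theorem SStep.close_bbeta_left {M N : Term G} {l : Lbl G} {T} (h : SStep M l T) :
    Close .beta l (fun _ _ => inst M N) (fun k b => app (Term.blam (T k b)) (bang N)) := by
  refine ⟨Finset.disjoint_empty_left _, fun _ _ k b => inst (T k b) N, fun _ _ => ?_,
    fun k b => .bbeta _ _⟩
  simp only [inst_eq]
  exact h.subst _

/-- Linearity is essential here: the argument is neither erased, copied nor hidden, so its step is
matched by exactly one surface step of the reduct. For `λ!` the question does not arise, as `bang N`
has no surface step. -/
theorem SStep.close_beta_right {M N : Term G} {l : Lbl G} {T} (h : SStep N l T)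
    (hM : LinearLams (Term.lam M)) :
    Close .beta l (fun _ _ => inst M N) (fun k b => app (Term.lam M) (T k b)) :=
  ⟨Finset.disjoint_empty_left _, fun _ _ k b => inst M (T k b),
    fun _ _ => h.inst_linear hM.1 hM.2.1, fun _ _ => .beta _ _⟩

/-- Only β-redexes can contain other surface redexes, in the body or, for linear ones, in the
argument. All other pairs of distinct surface redexes are in disjoint subterms, and since registers
do not repeat, they act on disjoint registers. -/
theorem SStep.diamond {M : Term G} {l l' : Lbl G} {T T'} (h : SStep M l T) (h' : SStep M l' T')
    (hM : LinearLams M) (hr : ∀ i, regSurfOcc i M ≤ 1) :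
    (l = l' ∧ T = T') ∨ Close l l' T T' := by
  induction h generalizing l' T' with
  | beta M N =>
    cases h' with
    | beta => exact .inl ⟨rfl, rfl⟩
    | appL _ h' => cases h' with | lam h' => exact .inr h'.close_beta_left
    | appR _ h' => exact .inr (h'.close_beta_right hM.1)
  | bbeta M N =>
    cases h' with
    | bbeta => exact .inl ⟨rfl, rfl⟩
    | appL _ h' => cases h' with | blam h' => exact .inr h'.close_bbeta_left
    | appR _ h' => cases h'
  | new => cases h'; exact .inl ⟨rfl, rfl⟩
  | meas i M N =>
    cases h' with
    | meas => exact .inl ⟨rfl, rfl⟩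
    | measS _ _ h' => cases h'
  | u1 A i =>
    cases h' with
    | u1 => exact .inl ⟨rfl, rfl⟩
    | appL _ h' => cases h'
    | appR _ h' => cases h'
  | u2 A i j =>
    cases h' with
    | u2 => exact .inl ⟨rfl, rfl⟩
    | appL _ h' => cases h'
    -- The encoded pair of registers has no surface step.
    | appR _ h' =>
      cases h' with
      | lam h' =>
        cases h' with
        | appL _ h' =>
          cases h' with
          | appL _ h' => cases h'
          | appR _ h' => cases h'
        | appR _ h' => cases h'
  | appL N h ih =>
    cases h' with
    | beta => cases h with | lam h => exact .inr h.close_beta_left.symm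
    | bbeta => cases h with | blam h => exact .inr h.close_bbeta_left.symm
    | u1 => cases h
    | u2 => cases h
    | appL _ h' =>
      rcases ih h' hM.1 fun i => le_trans (Nat.le_add_right _ _) (hr i) with ⟨rfl, rfl⟩ | hc
      · exact .inl ⟨rfl, rfl⟩
      · exact .inr (hc.map (fun M => app M N) fun h => .appL N h)
    | appR _ h' => exact .inr (h.close_app h' hr)
  | appR M h ih =>
    cases h' with
    | beta => exact .inr (h.close_beta_right hM.1).symm
    | bbeta => cases h
    | u1 => cases h
    | u2 =>
      cases h with
      | lam h =>
        cases h with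
        | appL _ h =>
          cases h with
          | appL _ h => cases h
          | appR _ h => cases h
        | appR _ h => cases h
    | appL _ h' => exact .inr (h'.close_app h hr).symm
    | appR _ h' =>
      rcases ih h' hM.2 fun i => le_trans (Nat.le_add_left _ _) (hr i) with ⟨rfl, rfl⟩ | hc
      · exact .inl ⟨rfl, rfl⟩
      · exact .inr (hc.map (fun N => app M N) fun h => .appR M h)
  | lam h ih =>
    cases h' with
    | lam h' =>
      rcases ih h' hM.2.2 hr with ⟨rfl, rfl⟩ | hc
      · exact .inl ⟨rfl, rfl⟩
      · exact .inr (hc.map Term.lam fun h => .lam h)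
  | blam h ih =>
    cases h' with
    | blam h' =>
      rcases ih h' hM hr with ⟨rfl, rfl⟩ | hc
      · exact .inl ⟨rfl, rfl⟩
      · exact .inr (hc.map Term.blam fun h => .blam h)
  | measS M N h ih =>
    cases h' with
    | meas => cases h
    | measS _ _ h' =>
      rcases ih h' hM.1 hr with ⟨rfl, rfl⟩ | hc
      · exact .inl ⟨rfl, rfl⟩
      · exact .inr (hc.map (fun P => Term.meas P M N) fun h => .measS M N h)

/-! ### The probability of termination -/

/-- Terms without surface steps. -/
def SN (M : Term G) : Prop := ∀ l T, ¬ SStep M l T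

/-- The reducts of a configuration for a step, valued by `w`. -/
noncomputable def stepVal (w : St → Term G → ℝ≥0∞) (Q : St) (l : Lbl G) (T : Bool → Term G) :
    ℝ≥0∞ := ∑ b, w (act l b Q) (T b)

open Classical in
/-- The largest probability to be in surface normal form after `n` strict surface steps. -/
noncomputable def value : ℕ → St → Term G → ℝ≥0∞
  | 0, Q, M => if SN M then nsq Q else 0
  | n + 1, Q, M => if SN M then nsq Q else
      ⨆ (l : Lbl G) (T : ℕ → Bool → Term G) (k : ℕ) (_ : SStep M l T ∧ regOcc k M = 0),
        stepVal (value n) Q l (T k)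

theorem value_of_SN {M : Term G} (h : SN M) (n : ℕ) (Q : St) : value n Q M = nsq Q := by
  cases n <;> simp [value, h]

theorem SStep.not_SN {M : Term G} {l : Lbl G} {T} (h : SStep M l T) : ¬ SN M :=
  fun hn => hn _ _ h

theorem stepVal_mono {w w' : St → Term G → ℝ≥0∞} (h : ∀ Q M, w Q M ≤ w' Q M) (Q : St)
    (l : Lbl G) (T : Bool → Term G) : stepVal w Q l T ≤ stepVal w' Q l T :=
  Finset.sum_le_sum fun _ _ => h _ _

theorem stepVal_le_value {M : Term G} {l : Lbl G} {T} (h : SStep M l T) {k : ℕ}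
    (hk : regOcc k M = 0) (n : ℕ) (Q : St) : stepVal (value n) Q l (T k) ≤ value (n + 1) Q M := by
  rw [value, if_neg h.not_SN]
  exact le_iSup_of_le l (le_iSup_of_le T (le_iSup_of_le k (le_iSup_of_le ⟨h, hk⟩ le_rfl)))

theorem value_succ_le {M : Term G} (hM : ¬ SN M) {n : ℕ} {Q : St} {x : ℝ≥0∞}
    (h : ∀ l T k, SStep M l T → regOcc k M = 0 → stepVal (value n) Q l (T k) ≤ x) :
    value (n + 1) Q M ≤ x := by
  rw [value, if_neg hM]
  exact iSup_le fun l => iSup_le fun T => iSup_le fun k => iSup_le fun hk => h l T k hk.1 hk.2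

theorem value_le_succ (n : ℕ) (Q : St) (M : Term G) : value n Q M ≤ value (n + 1) Q M := by
  induction n generalizing Q M with
  | zero =>
    by_cases h : SN M
    · rw [value_of_SN h, value_of_SN h]
    · simp [value, h]
  | succ n ih =>
    by_cases h : SN M
    · rw [value_of_SN h, value_of_SN h]
    · refine value_succ_le h fun l T k hs hk => ?_
      exact (stepVal_mono ih _ _ _).trans (stepVal_le_value hs hk _ _)

theorem value_mono (Q : St) (M : Term G) : Monotone fun n => value n Q M :=
  monotone_nat_of_le_succ fun n => value_le_succ n Q M

/-- Quadratic homogeneity lets the amplitude of a measurement outcome stay in the state, where it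
acts as the weight of that outcome. -/
theorem value_smul (a : ℂ) (n : ℕ) (Q : St) (M : Term G) :
    value n (a • Q) M = ‖a‖ₑ ^ 2 * value n Q M := by
  induction n generalizing Q M with
  | zero =>
    by_cases h : SN M
    · rw [value_of_SN h, value_of_SN h, nsq_smul]
    · simp [value, h]
  | succ n ih =>
    by_cases h : SN M
    · rw [value_of_SN h, value_of_SN h, nsq_smul]
    · simp only [value, if_neg h, stepVal, map_smul, ih, ENNReal.mul_iSup, Finset.mul_sum]

theorem regOcc_mapReg (π : Equiv.Perm ℕ) (k : ℕ) (M : Term G) :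
    regOcc (π k) (mapReg π M) = regOcc k M := by
  induction M <;> simp_all [mapReg, regOcc]

theorem mapReg_symm_mapReg (π : Equiv.Perm ℕ) (M : Term G) :
    mapReg π.symm (mapReg π M) = M := by
  rw [mapReg_mapReg]
  simpa using mapReg_id M

theorem SN.of_mapReg {π : Equiv.Perm ℕ} {M : Term G} (h : SN (mapReg π M)) : SN M :=
  fun _ _ hs => h _ _ (hs.mapReg π)

theorem SN_mapReg (π : Equiv.Perm ℕ) (M : Term G) : SN (mapReg π M) ↔ SN M := by
  refine ⟨SN.of_mapReg, fun h => ?_⟩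
  rw [← mapReg_symm_mapReg π M] at h
  exact h.of_mapReg

/-- Steps and their actions are equivariant under permutations of the register names; applying this
to the inverse permutation gives equality. -/
theorem value_le_perm (π : Equiv.Perm ℕ) (n : ℕ) (Q : St) (M : Term G) :
    value n Q M ≤ value n (perm π Q) (mapReg π M) := by
  induction n generalizing Q M with
  | zero => by_cases h : SN M <;> simp [value, SN_mapReg, nsq_perm, h]
  | succ n ih =>
    by_cases h : SN M
    · rw [value_of_SN h, value_of_SN ((SN_mapReg π M).mpr h), nsq_perm]
    · refine value_succ_le h fun l T k hs hk => ?_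
      refine le_trans ?_ (stepVal_le_value (hs.mapReg π) (k := π k)
        (by rwa [regOcc_mapReg]) n (perm π Q))
      refine Finset.sum_le_sum fun b _ => (ih _ _).trans (le_of_eq ?_)
      rw [← Module.End.mul_apply, ← Module.End.mul_apply, act_perm, π.symm_apply_apply]

theorem value_perm (π : Equiv.Perm ℕ) (n : ℕ) (Q : St) (M : Term G) :
    value n (perm π Q) (mapReg π M) = value n Q M := by
  refine le_antisymm ?_ (value_le_perm π n Q M)
  refine (value_le_perm π.symm n _ _).trans_eq ?_
  rw [perm_symm_perm, mapReg_symm_mapReg]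

/-! ### Independence of the choice of steps -/

/-- Valid terms with a state of their registers. -/
def Good (Q : St) (M : Term G) : Prop := Valid M ∧ ∀ i, regOcc i M = 0 → Q ∈ van i

/-- A register can disappear only by being measured, and measurement leaves its qubit in `|0⟩`.
Qubits without a register in the term are not touched. -/
theorem Good.step {Q : St} {M : Term G} (h : Good Q M) {l : Lbl G} {T} (hs : SStep M l T) {k : ℕ}
    (hk : regOcc k M = 0) (b : Bool) : Good (act l b Q) (T k b) := by
  refine ⟨hs.valid h.1 hk b, fun i hi => ?_⟩
  have e := hs.regOcc_reduct h.1 k b i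
  by_cases h0 : regOcc i M = 0
  · refine act_mem_van (fun hi => ?_) (h.2 i h0) b
    have := hs.regSurfOcc_pos hi
    have := SStep.regSurfOcc_le i M
    omega
  · have hl : l.loss (unitW i) ≠ 0 := by omega
    cases l with
    | meas j =>
      have : j = i := by by_contra hji; exact hl (by simp [Lbl.loss, unitW, hji])
      subst this
      exact E_false_mem_van _ _ _
    | _ => exact absurd rfl hl

theorem SStep.reduct_fresh {M : Term G} {l : Lbl G} {T} (h : SStep M l T) (hM : Valid M) {k i : ℕ}
    (hk : k ≠ i) (hi : regOcc i M = 0) (b : Bool) : regOcc i (T k b) = 0 := by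
  have := h.regOcc_reduct hM k b i
  have h0 : l.gain (unitW i) k = 0 := by cases l <;> simp [Lbl.gain, unitW, hk]
  omega

/-- Swapping two fresh names exchanges the two reducts and fixes the state, because both qubits are
`|0⟩`. -/
theorem stepVal_rename {Q : St} {M : Term G} (hQ : Good Q M) {l : Lbl G} {T} (h : SStep M l T)
    {k k' : ℕ} (hk : regOcc k M = 0) (hk' : regOcc k' M = 0) (n : ℕ) :
    stepVal (value n) Q l (T k) = stepVal (value n) Q l (T k') := by
  refine Finset.sum_congr rfl fun b _ => ?_
  have hl {i : ℕ} (hi : regOcc i M = 0) : i ∉ l.regs := fun hi' => by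
    have := h.regSurfOcc_pos hi'
    have := SStep.regSurfOcc_le i M
    omega
  rw [← value_perm (Equiv.swap k k'), perm_swap (act_mem_van (hl hk) (hQ.2 k hk) b)
    (act_mem_van (hl hk') (hQ.2 k' hk') b), h.mapReg_reduct, Equiv.swap_apply_left]
  intro i hi
  exact Equiv.swap_apply_of_ne_of_ne (by rintro rfl; omega) (by rintro rfl; omega)

theorem exists_fresh (M : Term G) (k : ℕ) : ∃ i, k < i ∧ regOcc i M = 0 := by
  have key : ∃ m, ∀ i, m ≤ i → regOcc i M = 0 := by
    induction M with
    | reg j => exact ⟨j + 1, fun i hi => by simp [regOcc]; omega⟩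
    | app M N ihM ihN =>
      obtain ⟨m, hm⟩ := ihM
      obtain ⟨n, hn⟩ := ihN
      exact ⟨m + n, fun i hi => by simp [regOcc, hm i (by omega), hn i (by omega)]⟩
    | meas P M N ihP ihM ihN =>
      obtain ⟨p, hp⟩ := ihP
      obtain ⟨m, hm⟩ := ihM
      obtain ⟨n, hn⟩ := ihN
      exact ⟨p + m + n, fun i hi => by
        simp [regOcc, hp i (by omega), hm i (by omega), hn i (by omega)]⟩
    | bang M ih => exact ih
    | lam M ih => exact ih
    | blam M ih => exact ih
    | _ => exact ⟨0, fun _ _ => rfl⟩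
  obtain ⟨m, hm⟩ := key
  exact ⟨m + k + 1, by omega, hm _ (by omega)⟩

/-- Random descent: by the diamond property both steps can be continued to the same two-step
reducts, with the same final states since the actions commute. The two values are then one double
sum over outcomes, taken in either order. -/
theorem stepVal_eq {Q : St} {M : Term G} (hQ : Good Q M) {l l' : Lbl G} {T T'}
    (h : SStep M l T) (h' : SStep M l' T') {k k' : ℕ} (hk : regOcc k M = 0)
    (hk' : regOcc k' M = 0) (n : ℕ) :
    stepVal (value n) Q l (T k) = stepVal (value n) Q l' (T' k') := by
  induction n generalizing Q M l l' T T' k k' with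
  | zero =>
    rcases h.diamond h' hQ.1.2 (fun i => (hQ.1.1 i).2 ▸ (hQ.1.1 i).1) with ⟨rfl, rfl⟩ | hc
    · exact stepVal_rename hQ h hk hk' 0
    -- After either step the other one remains possible, so no reduct is normal and both values are
    -- `0`.
    · obtain ⟨-, U, h1, h2⟩ := hc
      simp [stepVal, value, (h1 _ _).not_SN, (h2 _ _).not_SN]
  | succ n ih =>
    rcases h.diamond h' hQ.1.2 (fun i => (hQ.1.1 i).2 ▸ (hQ.1.1 i).1) with ⟨rfl, rfl⟩ | hc
    · exact stepVal_rename hQ h hk hk' _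
    · obtain ⟨hd, U, h1, h2⟩ := hc
      -- If both steps allocate, their new registers must have different names, so the second step
      -- uses some `j ≠ k`.
      obtain ⟨j, hj, hj0⟩ := exists_fresh M k
      rw [stepVal_rename hQ h' hk' hj0]
      -- By the induction hypothesis all steps give the same value, so any of them attains the
      -- supremum.
      have val {Q : St} {M : Term G} (hQ : Good Q M) {l : Lbl G} {T} (h : SStep M l T) {k : ℕ}
          (hk : regOcc k M = 0) : value (n + 1) Q M = stepVal (value n) Q l (T k) :=
        le_antisymm (value_succ_le h.not_SN fun l' T' k' h' hk' => (ih hQ h' h hk' hk).le)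
          (stepVal_le_value h hk n Q)
      have e1 : stepVal (value (n + 1)) Q l (T k) =
          ∑ b, ∑ b', value n (act l' b' (act l b Q)) (U k b j b') :=
        Finset.sum_congr rfl fun b _ => val (hQ.step h hk b) (h1 k b)
          (h.reduct_fresh hQ.1 (by omega) hj0 b)
      have e2 : stepVal (value (n + 1)) Q l' (T' j) =
          ∑ b', ∑ b, value n (act l b (act l' b' Q)) (U k b j b') :=
        Finset.sum_congr rfl fun b _ => val (hQ.step h' hj0 b) (h2 j b)
          (h'.reduct_fresh hQ.1 (by omega) hk b)
      rw [e1, e2, Finset.sum_comm]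
      refine Finset.sum_congr rfl fun b _ => Finset.sum_congr rfl fun b' _ => ?_
      rw [← Module.End.mul_apply, ← Module.End.mul_apply, (act_commute hd b' b).eq]

theorem value_succ {Q : St} {M : Term G} (hQ : Good Q M) {l : Lbl G} {T} (h : SStep M l T) {k : ℕ}
    (hk : regOcc k M = 0) (n : ℕ) : value (n + 1) Q M = stepVal (value n) Q l (T k) :=
  le_antisymm (value_succ_le h.not_SN fun _ _ _ h' hk' => (stepVal_eq hQ h' h hk' hk n).le)
    (stepVal_le_value h hk n Q)

/-- The limit probability of termination. -/
noncomputable def limValue (Q : St) (M : Term G) : ℝ≥0∞ := ⨆ n, value n Q M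

theorem value_le_limValue (n : ℕ) (Q : St) (M : Term G) : value n Q M ≤ limValue Q M :=
  le_iSup (fun n => value n Q M) n

theorem limValue_step {Q : St} {M : Term G} (hQ : Good Q M) {l : Lbl G} {T} (h : SStep M l T)
    {k : ℕ} (hk : regOcc k M = 0) : limValue Q M = stepVal limValue Q l (T k) := by
  have e : limValue Q M = ⨆ n, value (n + 1) Q M :=
    ((value_mono Q M).iSup_nat_add 1).symm
  rw [e]
  simp only [value_succ hQ h hk, stepVal, limValue]
  exact (ENNReal.finsetSum_iSup_of_monotone fun b => value_mono _ _).symm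

/-! ### Parallel β-reduction -/

/-- Parallel β-reduction. -/
inductive Par : Term G → Term G → Prop
  | var (k : ℕ) : Par (var k) (var k)
  | bang {M M'} (h : Par M M') : Par (bang M) (bang M')
  | lam {M M'} (h : Par M M') : Par (lam M) (lam M')
  | blam {M M'} (h : Par M M') : Par (blam M) (blam M')
  | app {M M' N N'} (h : Par M M') (h' : Par N N') : Par (app M N) (app M' N')
  | reg (i : ℕ) : Par (reg i) (reg i)
  | gate1 (A : G.Un) : Par (gate1 A) (gate1 A)
  | gate2 (A : G.Bin) : Par (gate2 A) (gate2 A)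
  | new : Par new new
  | meas {P P' M M' N N'} (h : Par P P') (hM : Par M M') (hN : Par N N') :
      Par (meas P M N) (meas P' M' N')
  | beta {M M' N N'} (h : Par M M') (h' : Par N N') : Par (app (lam M) N) (inst M' N')
  | bbeta {M M' N N'} (h : Par M M') (h' : Par N N') : Par (app (blam M) (bang N)) (inst M' N')

/-- Parallel β-reduction of redexes that are not at surface positions. -/
inductive Deep : Term G → Term G → Prop
  | var (k : ℕ) : Deep (var k) (var k)
  | bang {M M'} (h : Par M M') : Deep (bang M) (bang M')
  | lam {M M'} (h : Deep M M') : Deep (lam M) (lam M')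
  | blam {M M'} (h : Deep M M') : Deep (blam M) (blam M')
  | app {M M' N N'} (h : Deep M M') (h' : Deep N N') : Deep (app M N) (app M' N')
  | reg (i : ℕ) : Deep (reg i) (reg i)
  | gate1 (A : G.Un) : Deep (gate1 A) (gate1 A)
  | gate2 (A : G.Bin) : Deep (gate2 A) (gate2 A)
  | new : Deep new new
  | meas {P P' M M' N N'} (h : Deep P P') (hM : Par M M') (hN : Par N N') :
      Deep (meas P M N) (meas P' M' N')

theorem Par.refl (M : Term G) : Par M M := by
  induction M with
  | var k => exact .var k
  | bang M ih => exact .bang ih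
  | lam M ih => exact .lam ih
  | blam M ih => exact .blam ih
  | app M N ihM ihN => exact .app ihM ihN
  | reg i => exact .reg i
  | gate1 A => exact .gate1 A
  | gate2 A => exact .gate2 A
  | new => exact .new
  | meas P M N ihP ihM ihN => exact .meas ihP ihM ihN

theorem Deep.par {M M' : Term G} (h : Deep M M') : Par M M' := by
  induction h with
  | var k => exact .var k
  | bang h => exact .bang h
  | lam h ih => exact .lam ih
  | blam h ih => exact .blam ih
  | app h h' ih ih' => exact .app ih ih'
  | reg i => exact .reg i
  | gate1 A => exact .gate1 A
  | gate2 A => exact .gate2 A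
  | new => exact .new
  | meas h hM hN ih => exact .meas ih hM hN

theorem rename_inst (ρ : ℕ → ℕ) (M N : Term G) :
    rename ρ (inst M N) = inst (rename (liftRen ρ) M) (rename ρ N) := by
  rw [rename_eq_subst, subst_inst, liftSub_var_comp, ← rename_eq_subst, ← rename_eq_subst]

theorem Par.rename {M M' : Term G} (h : Par M M') (ρ : ℕ → ℕ) :
    Par (rename ρ M) (rename ρ M') := by
  induction h generalizing ρ with
  | var k => exact .var _
  | bang h ih => exact .bang (ih _)
  | lam h ih => exact .lam (ih _)
  | blam h ih => exact .blam (ih _)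
  | app h h' ih ih' => exact .app (ih _) (ih' _)
  | reg i => exact .reg i
  | gate1 A => exact .gate1 A
  | gate2 A => exact .gate2 A
  | new => exact .new
  | meas h hM hN ih ihM ihN => exact .meas (ih _) (ihM _) (ihN _)
  | beta h h' ih ih' => rw [rename_inst]; exact .beta (ih _) (ih' _)
  | bbeta h h' ih ih' => rw [rename_inst]; exact .bbeta (ih _) (ih' _)

theorem Par.liftSub {s s' : ℕ → Term G} (hs : ∀ k, Par (s k) (s' k)) (k : ℕ) :
    Par (liftSub s k) (liftSub s' k) := by
  cases k
  · exact .var 0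
  · exact (hs _).rename _

theorem Par.subst {M M' : Term G} (h : Par M M') {s s' : ℕ → Term G}
    (hs : ∀ k, Par (s k) (s' k)) : Par (subst s M) (subst s' M') := by
  induction h generalizing s s' with
  | var k => exact hs k
  | bang h ih => exact .bang (ih hs)
  | lam h ih => exact .lam (ih (Par.liftSub hs))
  | blam h ih => exact .blam (ih (Par.liftSub hs))
  | app h h' ih ih' => exact .app (ih hs) (ih' hs)
  | reg i => exact .reg i
  | gate1 A => exact .gate1 A
  | gate2 A => exact .gate2 A
  | new => exact .new
  | meas h hM hN ih ihM ihN => exact .meas (ih hs) (ihM hs) (ihN hs)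
  | beta h h' ih ih' => rw [subst_inst]; exact .beta (ih (Par.liftSub hs)) (ih' hs)
  | bbeta h h' ih ih' => rw [subst_inst]; exact .bbeta (ih (Par.liftSub hs)) (ih' hs)

theorem Par.inst {M M' N N' : Term G} (h : Par M M') (h' : Par N N') :
    Par (inst M N) (inst M' N') := by
  rw [inst_eq, inst_eq]
  refine h.subst fun k => ?_
  cases k
  · exact h'
  · exact .var _

/-! ### Factorization: surface β-steps first, then deep reduction -/

/-- Sequences of surface β-steps. -/
inductive SurfBetas : Term G → Term G → Prop
  | refl (M : Term G) : SurfBetas M M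
  | head {M N P : Term G} (h : SStep M .beta fun _ _ => N) (h' : SurfBetas N P) : SurfBetas M P

namespace SurfBetas

theorem trans {M N P : Term G} (h : SurfBetas M N) (h' : SurfBetas N P) : SurfBetas M P := by
  induction h with
  | refl => exact h'
  | head h _ ih => exact .head h (ih h')

theorem map {M N : Term G} (h : SurfBetas M N) (F : Term G → Term G)
    (hF : ∀ {M l T}, SStep M l T → SStep (F M) l fun k b => F (T k b)) :
    SurfBetas (F M) (F N) := by
  induction h with
  | refl => exact .refl _
  | head h _ ih => exact .head (hF h) ih

theorem app {M M' N N' : Term G} (h : SurfBetas M M') (h' : SurfBetas N N') :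
    SurfBetas (app M N) (app M' N') :=
  (h.map (fun M => Term.app M N) fun h => .appL N h).trans
    (h'.map (fun N => Term.app M' N) fun h => .appR M' h)

end SurfBetas

/-- A factorization of a parallel reduction: surface steps first. -/
def Fact (M M' : Term G) : Prop := ∃ U, SurfBetas M U ∧ Deep U M'

theorem Deep.rename {M M' : Term G} (h : Deep M M') (ρ : ℕ → ℕ) :
    Deep (rename ρ M) (rename ρ M') := by
  induction h generalizing ρ with
  | var k => exact .var _
  | bang h => exact .bang (h.rename _)
  | lam h ih => exact .lam (ih _)
  | blam h ih => exact .blam (ih _)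
  | app h h' ih ih' => exact .app (ih _) (ih' _)
  | reg i => exact .reg i
  | gate1 A => exact .gate1 A
  | gate2 A => exact .gate2 A
  | new => exact .new
  | meas h hM hN ih => exact .meas (ih _) (hM.rename _) (hN.rename _)

theorem Fact.rename {M M' : Term G} (h : Fact M M') (ρ : ℕ → ℕ) :
    Fact (rename ρ M) (rename ρ M') := by
  obtain ⟨U, h1, h2⟩ := h
  exact ⟨_, h1.map (Term.rename ρ) fun h => h.rename ρ, h2.rename ρ⟩

/-- At surface occurrences of variables the factorization `hf` supplies the surface steps. At the
other occurrences the reduction `hs` takes place under `!` or in a branch, so it is deep already. -/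
theorem Deep.fact_subst {M M' : Term G} (h : Deep M M') {s s' : ℕ → Term G}
    (hs : ∀ k, Par (s k) (s' k)) (hf : ∀ k, Fact (s k) (s' k)) :
    Fact (subst s M) (subst s' M') := by
  have liftF {s s' : ℕ → Term G} (hf : ∀ k, Fact (s k) (s' k)) (k : ℕ) :
      Fact (liftSub s k) (liftSub s' k) := by
    cases k
    · exact ⟨_, .refl _, .var 0⟩
    · exact (hf _).rename _
  induction h generalizing s s' with
  | var k => exact hf k
  | bang h => exact ⟨_, .refl _, .bang (h.subst hs)⟩
  | lam h ih =>
    obtain ⟨U, h1, h2⟩ := ih (Par.liftSub hs) (liftF hf)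
    exact ⟨_, h1.map Term.lam fun h => .lam h, .lam h2⟩
  | blam h ih =>
    obtain ⟨U, h1, h2⟩ := ih (Par.liftSub hs) (liftF hf)
    exact ⟨_, h1.map Term.blam fun h => .blam h, .blam h2⟩
  | app h h' ih ih' =>
    obtain ⟨U, h1, h2⟩ := ih hs hf
    obtain ⟨V, h3, h4⟩ := ih' hs hf
    exact ⟨_, h1.app h3, .app h2 h4⟩
  | reg i => exact ⟨_, .refl _, .reg i⟩
  | gate1 A => exact ⟨_, .refl _, .gate1 A⟩
  | gate2 A => exact ⟨_, .refl _, .gate2 A⟩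
  | new => exact ⟨_, .refl _, .new⟩
  | meas h hM hN ih =>
    obtain ⟨U, h1, h2⟩ := ih hs hf
    exact ⟨_, h1.map (fun P => Term.meas P _ _) fun h => .measS _ _ h,
      .meas h2 (hM.subst hs) (hN.subst hs)⟩

theorem Fact.inst {M M' N N' : Term G} (h : Fact M M') (h' : Par N N') (hN : Fact N N') :
    Fact (inst M N) (inst M' N') := by
  obtain ⟨U, h1, h2⟩ := h
  rw [inst_eq, inst_eq]
  have : Fact (subst (single N) U) (subst (single N') M') := by
    refine h2.fact_subst (fun k => ?_) fun k => ?_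
    · cases k
      · exact h'
      · exact .var _
    · cases k
      · exact hN
      · exact ⟨_, .refl _, .var _⟩
  obtain ⟨V, h3, h4⟩ := this
  exact ⟨V, (h1.map (subst (single N)) fun h => h.subst _).trans h3, h4⟩

/-- A contracted redex at a surface position is fired first; its reduct factors by `Fact.inst` and
the induction hypotheses. Under `!` and in branches everything is deep. -/
theorem Par.fact {M M' : Term G} (h : Par M M') : Fact M M' := by
  induction h with
  | var k => exact ⟨_, .refl _, .var k⟩
  | bang h ih => exact ⟨_, .refl _, .bang h⟩
  | lam h ih =>
    obtain ⟨U, h1, h2⟩ := ih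
    exact ⟨_, h1.map Term.lam fun h => .lam h, .lam h2⟩
  | blam h ih =>
    obtain ⟨U, h1, h2⟩ := ih
    exact ⟨_, h1.map Term.blam fun h => .blam h, .blam h2⟩
  | app h h' ih ih' =>
    obtain ⟨U, h1, h2⟩ := ih
    obtain ⟨V, h3, h4⟩ := ih'
    exact ⟨_, h1.app h3, .app h2 h4⟩
  | reg i => exact ⟨_, .refl _, .reg i⟩
  | gate1 A => exact ⟨_, .refl _, .gate1 A⟩
  | gate2 A => exact ⟨_, .refl _, .gate2 A⟩
  | new => exact ⟨_, .refl _, .new⟩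
  | meas h hM hN ih =>
    obtain ⟨U, h1, h2⟩ := ih
    exact ⟨_, h1.map (fun P => Term.meas P _ _) fun h => .measS _ _ h, .meas h2 hM hN⟩
  | beta h h' ih ih' =>
    obtain ⟨U, h1, h2⟩ := ih.inst h' ih'
    exact ⟨U, .head (.beta _ _) h1, h2⟩
  | bbeta h h' ih ih' =>
    obtain ⟨U, h1, h2⟩ := ih.inst h' ih'
    exact ⟨U, .head (.bbeta _ _) h1, h2⟩

/-! ### Surface steps and deep reduction -/

/-- Surface steps after a deep reduction can be done first. -/
theorem Deep.step {M M' : Term G} (h : Deep M M') {l : Lbl G} {T'} (h' : SStep M' l T') :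
    ∃ T, SStep M l T ∧ ∀ k b, Par (T k b) (T' k b) := by
  induction h' generalizing M with
  | beta A B =>
    cases h with
    | app h h' => cases h with | lam h => exact ⟨_, .beta _ _, fun _ _ => h.par.inst h'.par⟩
  | bbeta A B =>
    cases h with
    | app h h' =>
      cases h with
      | blam h => cases h' with | bang h' => exact ⟨_, .bbeta _ _, fun _ _ => h.par.inst h'⟩
  | new => cases h; exact ⟨_, .new, fun _ _ => .refl _⟩
  | meas i A B =>
    cases h with
    | meas h hM hN =>
      cases h
      refine ⟨_, .meas _ _ _, fun _ b => ?_⟩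
      cases b
      exacts [hM, hN]
  | u1 A i =>
    cases h with
    | app h h' => cases h; cases h'; exact ⟨_, .u1 _ _, fun _ _ => .refl _⟩
  | u2 A i j =>
    cases h with
    | app h h' =>
      cases h
      cases h' with
      | lam h =>
        cases h with
        | app h1 h2 =>
          cases h2
          cases h1 with
          | app h1 h2 => cases h1; cases h2; exact ⟨_, .u2 _ _ _, fun _ _ => .refl _⟩
  | appL B hs ih =>
    cases h with
    | app h h' =>
      obtain ⟨T, h1, h2⟩ := ih h
      exact ⟨_, .appL _ h1, fun k b => .app (h2 k b) h'.par⟩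
  | appR A hs ih =>
    cases h with
    | app h h' =>
      obtain ⟨T, h1, h2⟩ := ih h'
      exact ⟨_, .appR _ h1, fun k b => .app h.par (h2 k b)⟩
  | lam hs ih =>
    cases h with
    | lam h =>
      obtain ⟨T, h1, h2⟩ := ih h
      exact ⟨_, .lam h1, fun k b => .lam (h2 k b)⟩
  | blam hs ih =>
    cases h with
    | blam h =>
      obtain ⟨T, h1, h2⟩ := ih h
      exact ⟨_, .blam h1, fun k b => .blam (h2 k b)⟩
  | measS A B hs ih =>
    cases h with
    | meas h hM hN =>
      obtain ⟨T, h1, h2⟩ := ih h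
      exact ⟨_, .measS _ _ h1, fun k b => .meas (h2 k b) hM hN⟩

/-- Deep reduction does not destroy surface redexes. -/
theorem Deep.step_forward {M M' : Term G} (h : Deep M M') {l : Lbl G} {T} (h' : SStep M l T) :
    ∃ T', SStep M' l T' := by
  induction h' generalizing M' with
  | beta A B =>
    cases h with
    | app h h' => cases h; exact ⟨_, .beta _ _⟩
  | bbeta A B =>
    cases h with
    | app h h' => cases h; cases h'; exact ⟨_, .bbeta _ _⟩
  | new => cases h; exact ⟨_, .new⟩
  | meas i A B =>
    cases h with
    | meas h hM hN => cases h; exact ⟨_, .meas _ _ _⟩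
  | u1 A i =>
    cases h with
    | app h h' => cases h; cases h'; exact ⟨_, .u1 _ _⟩
  | u2 A i j =>
    cases h with
    | app h h' =>
      cases h
      cases h' with
      | lam h =>
        cases h with
        | app h1 h2 =>
          cases h2
          cases h1 with
          | app h1 h2 => cases h1; cases h2; exact ⟨_, .u2 _ _ _⟩
  | appL B hs ih =>
    cases h with
    | app h h' => exact (ih h).elim fun T h1 => ⟨_, .appL _ h1⟩
  | appR A hs ih =>
    cases h with
    | app h h' => exact (ih h').elim fun T h1 => ⟨_, .appR _ h1⟩
  | lam hs ih =>
    cases h with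
    | lam h => exact (ih h).elim fun T h1 => ⟨_, .lam h1⟩
  | blam hs ih =>
    cases h with
    | blam h => exact (ih h).elim fun T h1 => ⟨_, .blam h1⟩
  | measS A B hs ih =>
    cases h with
    | meas h hM hN => exact (ih h).elim fun T h1 => ⟨_, .measS _ _ h1⟩

theorem Deep.regSurfOcc_eq {M M' : Term G} (h : Deep M M') (i : ℕ) :
    regSurfOcc i M = regSurfOcc i M' := by
  induction h <;> simp_all [regSurfOcc]

/-! ### Probability of termination along parallel β-reduction -/

theorem stepVal_beta (w : St → Term G → ℝ≥0∞) (hw : ∀ M, w 0 M = 0) (Q : St)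
    (T : Bool → Term G) : stepVal w Q .beta T = w Q (T true) := by
  simp [stepVal, act, hw]

theorem value_zero (n : ℕ) (M : Term G) : value n 0 M = 0 := by
  have := value_smul 0 n 0 M
  simpa using this

theorem limValue_zero (M : Term G) : limValue 0 M = 0 := by
  simp [limValue, value_zero]

theorem SurfBetas.limValue_eq {M M' : Term G} (h : SurfBetas M M') {Q : St} (hQ : Good Q M) :
    Good Q M' ∧ limValue Q M = limValue Q M' := by
  induction h with
  | refl M => exact ⟨hQ, rfl⟩
  | @head M N P h h' ih =>
    obtain ⟨k, -, hk⟩ := exists_fresh M 0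
    have hg : Good Q N := by simpa [act] using hQ.step h hk true
    refine ⟨(ih hg).1, ?_⟩
    rw [limValue_step hQ h hk, stepVal_beta _ limValue_zero, (ih hg).2]

/-- Parallel β-reduction does not increase the probability of termination. -/
theorem Par.value_le {M M' : Term G} (h : Par M M') {Q : St} (hQ : Good Q M) (n : ℕ) :
    value n Q M' ≤ limValue Q M := by
  induction n generalizing Q M M' with
  | zero =>
    obtain ⟨U, h1, h2⟩ := h.fact
    rw [(h1.limValue_eq hQ).2]
    refine le_trans ?_ (value_le_limValue 0 Q U)
    by_cases hM : SN M'
    · have hU : SN U := fun l T hs => (h2.step_forward hs).elim fun _ hs' => hM _ _ hs'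
      rw [value_of_SN hM, value_of_SN hU]
    · simp [value, hM]
  | succ n ih =>
    obtain ⟨U, h1, h2⟩ := h.fact
    obtain ⟨hg, he⟩ := h1.limValue_eq hQ
    rw [he]
    by_cases hM : SN M'
    · have hU : SN U := fun l T hs => (h2.step_forward hs).elim fun _ hs' => hM _ _ hs'
      rw [value_of_SN hM, ← value_of_SN hU 0]
      exact value_le_limValue 0 Q U
    -- Bounding the supremum over all steps of `M'` requires no validity of `M'`; each step is
    -- pulled back to the valid term `U`.
    · refine value_succ_le hM fun l T' k hs hk => ?_
      obtain ⟨T, hs', hT⟩ := h2.step hs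
      -- Deep reduction keeps the surface registers, and all registers of `U` are surface.
      have hk' : regOcc k U = 0 := by
        have := SStep.regSurfOcc_le k M'
        rw [← (hg.1.1 k).2, h2.regSurfOcc_eq]
        omega
      rw [limValue_step hg hs' hk']
      exact Finset.sum_le_sum fun b _ => ih (hT k b) (hg.step hs' hk' b)

theorem Par.limValue_le {M M' : Term G} (h : Par M M') {Q : St} (hQ : Good Q M) :
    limValue Q M' ≤ limValue Q M := iSup_le fun n => h.value_le hQ n

/-! ### Norms of states -/

theorem sum_norm_sq_mulVec {ι : Type*} [Fintype ι] [DecidableEq ι] (A : Matrix.unitaryGroup ι ℂ)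
    (q : ι → ℂ) :
    ∑ x, ‖∑ b, (A : Matrix ι ι ℂ) x b * q b‖ ^ 2 = ∑ x, ‖q x‖ ^ 2 := by
  have h (r : ι → ℂ) : ((∑ x, ‖r x‖ ^ 2 : ℝ) : ℂ) = star r ⬝ᵥ r := by
    simp [dotProduct, Complex.conj_mul']
  have h1 := h ((A : Matrix ι ι ℂ).mulVec q)
  rw [Matrix.star_mulVec, Matrix.dotProduct_mulVec, Matrix.vecMul_vecMul,
    ← Matrix.star_eq_conjTranspose, Matrix.UnitaryGroup.star_mul_self, Matrix.vecMul_one, ← h] at h1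
  exact_mod_cast h1

/-- A unitary matrix that acts on one component of the indices preserves the norm. -/
theorem sum_norm_sq_local {ι κ : Type*} [Fintype ι] [DecidableEq ι] [Nonempty ι] [Fintype κ]
    (A : Matrix.unitaryGroup ι ℂ) (get : κ → ι) (put : ι → κ → κ)
    (hgp : ∀ x c, get (put x c) = x) (hpp : ∀ x y c, put y (put x c) = put y c)
    (hpg : ∀ c, put (get c) c = c) (Q : κ → ℂ) :
    ∑ c, ‖∑ b, (A : Matrix ι ι ℂ) (get c) b * Q (put b c)‖ ^ 2 = ∑ c, ‖Q c‖ ^ 2 := by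
  -- Exchanging the component of `c` with the extra index `x` shows that averaging over the
  -- component does not change a sum over `κ`. The claim then reduces to unitarity on each fibre.
  have inv : Function.Involutive fun p : κ × ι => (put p.2 p.1, get p.1) := fun p => by
    simp [hgp, hpp, hpg]
  have key (F : κ → ℝ) : ∑ c, ∑ x, F (put x c) = Fintype.card ι * ∑ c, F c := by
    have := Equiv.sum_comp inv.toPerm fun p : κ × ι => F p.1
    rw [Fintype.sum_prod_type, Fintype.sum_prod_type] at this
    simpa [Finset.mul_sum] using this
  have h := key fun c => ‖∑ b, (A : Matrix ι ι ℂ) (get c) b * Q (put b c)‖ ^ 2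
  simp only [hgp, hpp, sum_norm_sq_mulVec A fun b => Q (put b _)] at h
  rw [key fun c => ‖Q c‖ ^ 2] at h
  exact (mul_left_cancel₀ (by simp) h).symm

namespace QState

theorem norm_apply1 {n : ℕ} (A : Matrix.unitaryGroup Bool ℂ) (Q : QState (n + 1)) :
    ‖Q.apply1 (A : Matrix Bool Bool ℂ)‖ = ‖Q‖ := by
  rw [← sq_eq_sq₀ (norm_nonneg _) (norm_nonneg _), EuclideanSpace.norm_sq_eq,
    EuclideanSpace.norm_sq_eq]
  exact sum_norm_sq_local A (fun c : Fin (n + 1) → Bool => c 0) (fun b c => Function.update c 0 b)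
    (by simp) (by simp) (by simp) Q

theorem norm_apply2 {n : ℕ} (A : Matrix.unitaryGroup (Bool × Bool) ℂ) (Q : QState (n + 2)) :
    ‖Q.apply2 (A : Matrix (Bool × Bool) (Bool × Bool) ℂ)‖ = ‖Q‖ := by
  rw [← sq_eq_sq₀ (norm_nonneg _) (norm_nonneg _), EuclideanSpace.norm_sq_eq,
    EuclideanSpace.norm_sq_eq]
  refine sum_norm_sq_local A (fun c : Fin (n + 2) → Bool => (c 0, c 1))
    (fun b c => Function.update (Function.update c 0 b.1) 1 b.2) ?_ ?_ ?_ Q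
  · intro x c
    simp
  · intro x y c
    funext i
    simp only [Function.update_apply]
    split_ifs <;> rfl
  · intro c
    simp

/-- The component of `Q` along `|b⟩` of the last qubit. -/
noncomputable def comp {n : ℕ} (Q : QState (n + 1)) (b : Bool) : QState n :=
  WithLp.toLp 2 fun c => Q (Fin.snoc c b)

theorem eq_snoc_add_snoc {n : ℕ} (Q : QState (n + 1)) :
    Q = (Q.comp false).snoc false + (Q.comp true).snoc true := by
  ext c
  have e : (Fin.snoc (fun i => c (Fin.castSucc i)) (c (Fin.last n)) : Fin (n + 1) → Bool) = c :=
    Fin.snoc_init_self c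
  cases h : c (Fin.last n) <;> rw [h] at e <;> simp [snoc, comp, h, e]

theorem norm_sq_comp {n : ℕ} (Q : QState (n + 1)) :
    ‖Q.comp false‖ ^ 2 + ‖Q.comp true‖ ^ 2 = ‖Q‖ ^ 2 := by
  simp only [EuclideanSpace.norm_sq_eq]
  rw [← (Fin.snocEquiv fun _ : Fin (n + 1) => Bool).sum_comp, Fintype.sum_prod_type]
  simp [comp, Fin.snocEquiv, add_comm]

theorem snoc_smul {n : ℕ} (a : ℂ) (Q : QState n) (b : Bool) :
    (a • Q).snoc b = a • Q.snoc b := by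
  ext c
  simp [snoc]

/-- The measurement rule asks for normalized components even when an amplitude vanishes; any unit
vector serves in that case. -/
theorem exists_unit {n : ℕ} (Q : QState n) : ∃ R : QState n, ‖R‖ = 1 ∧ Q = (‖Q‖ : ℂ) • R := by
  by_cases h : Q = 0
  · exact ⟨EuclideanSpace.single (fun _ => false) 1, by simp, by simp [h]⟩
  · have h' : (‖Q‖ : ℂ) ≠ 0 := by simpa using h
    refine ⟨(‖Q‖ : ℂ)⁻¹ • Q, ?_, ?_⟩
    · rw [norm_smul]; simp [h]
    · rw [smul_smul, mul_inv_cancel₀ h', one_smul]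

end QState

/-! ### Embedding of states of finitely many qubits -/

/-- The tensor product of `Q` with `|0⟩` for all other qubits. -/
noncomputable def embed {n : ℕ} (Q : QState n) : St :=
  open Classical in fun c => if ∀ i, n ≤ i → c i = false then Q fun i => c i else 0

theorem embed_smul {n : ℕ} (a : ℂ) (Q : QState n) : embed (a • Q) = a • embed Q := by
  funext c
  simp [embed]

theorem embed_add {n : ℕ} (Q R : QState n) : embed (Q + R) = embed Q + embed R := by
  funext c
  simp only [embed, Pi.add_apply, PiLp.add_apply]
  split_ifs <;> simp

theorem embed_mem_van {n i : ℕ} (h : n ≤ i) (Q : QState n) : embed Q ∈ van i := by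
  intro c hc
  refine if_neg fun h' => ?_
  simp [h' i h] at hc

theorem nsq_embed {n : ℕ} (Q : QState n) : nsq (embed Q) = ENNReal.ofReal (‖Q‖ ^ 2) := by
  let ext : (Fin n → Bool) → ℕ → Bool := fun b i => if h : i < n then b ⟨i, h⟩ else false
  have hext (b : Fin n → Bool) : embed Q (ext b) = Q b := by
    rw [embed, if_pos fun i hi => by simp [ext, not_lt.mpr hi]]
    refine congrArg Q.ofLp (funext fun i => ?_)
    simp [ext]
  have hinj : Function.Injective ext := fun b b' h => by
    funext i
    have := congrFun h i
    simpa [ext] using this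
  rw [nsq, ← hinj.tsum_eq, tsum_fintype, EuclideanSpace.norm_sq_eq,
    ENNReal.ofReal_sum_of_nonneg fun _ _ => sq_nonneg _]
  · refine Finset.sum_congr rfl fun b _ => ?_
    rw [hext, ENNReal.ofReal_pow (norm_nonneg _), ofReal_norm]
  · intro c hc
    refine ⟨fun i => c i, ?_⟩
    have h : ∀ i, n ≤ i → c i = false := by
      by_contra h
      exact hc (by simp [embed, h])
    funext i
    by_cases hi : i < n
    · simp [ext, hi]
    · simp [ext, hi, h i (not_lt.mp hi)]

theorem embed_snoc_apply {n : ℕ} (Q : QState n) (b : Bool) (c : ℕ → Bool) :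
    embed (Q.snoc b) c = if c n = b then embed Q (Function.update c n false) else 0 := by
  have e : (∀ i, n ≤ i → Function.update c n false i = false) ↔ ∀ i, n + 1 ≤ i → c i = false := by
    refine ⟨fun h i hi => ?_, fun h i hi => ?_⟩
    · have := h i (by omega)
      rwa [Function.update_of_ne (by omega)] at this
    · rcases eq_or_ne i n with rfl | hin
      · simp
      · rw [Function.update_of_ne hin]
        exact h i (by omega)
  have e' : (fun i : Fin n => Function.update c n false i) = fun i : Fin n => c i := by
    funext i
    exact Function.update_of_ne i.2.ne _ _
  by_cases hc : ∀ i, n + 1 ≤ i → c i = false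
  · rw [embed, embed, if_pos hc, if_pos (e.mpr hc), e']
    rfl
  · rw [embed, embed, if_neg hc, if_neg (mt e.mp hc), ite_self]

theorem embed_snoc_false {n : ℕ} (Q : QState n) : embed (Q.snoc false) = embed Q := by
  funext c
  rw [embed_snoc_apply]
  split_ifs with h
  · rw [← h, Function.update_eq_self]
  · exact (embed_mem_van le_rfl Q c (by simpa using h)).symm

/-- Since the last qubit is reset to `|0⟩`, the branch is again an embedded state of `n` qubits,
still multiplied by its amplitude. -/
theorem act_meas_embed {n : ℕ} (a₀ a₁ : ℂ) (Q₀ Q₁ : QState n) (b : Bool) :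
    act (.meas n : Lbl G) b (embed (a₀ • Q₀.snoc false + a₁ • Q₁.snoc true)) =
      cond b a₁ a₀ • embed (cond b Q₁ Q₀) := by
  funext c
  rw [embed_add, embed_smul, embed_smul]
  simp only [act, E_apply, Pi.add_apply, Pi.smul_apply, embed_snoc_apply, Function.update_self,
    Function.update_idem]
  by_cases h : c n = false
  · have e : Function.update c n false = c := by rw [← h, Function.update_eq_self]
    cases b <;> simp [h, e]
  · have h' : c n = true := by simpa using h
    cases b <;> simp [h, embed_mem_van le_rfl _ c h']

theorem embed_update {n : ℕ} (Q : QState n) (c : ℕ → Bool) (hc : ∀ i, n ≤ i → c i = false)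
    (k : Fin n) (b : Bool) : embed Q (Function.update c k b) =
      Q (Function.update (fun i : Fin n => c i) k b) := by
  rw [embed, if_pos fun i hi => by rw [Function.update_of_ne (by omega)]; exact hc i hi]
  exact congrArg Q.ofLp (Function.update_comp_eq_of_injective c Fin.val_injective k b)

theorem act_u1_embed {n : ℕ} (Q : QState (n + 1)) (A : G.Un) :
    act (.u1 A 0) true (embed Q) = embed (Q.apply1 (G.mat1 A : Matrix Bool Bool ℂ)) := by
  have hl : (.u1 A 0 : Lbl G).regs = {0} := rfl
  funext c
  by_cases hc : ∀ i, n + 1 ≤ i → c i = false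
  · rw [embed, if_pos hc]
    simp only [act, if_true, LinearMap.sum_apply, LinearMap.smul_apply, Finset.sum_apply,
      Pi.smul_apply, E_apply, QState.apply1, smul_eq_mul]
    rw [Finset.sum_eq_single (c 0) (fun x _ hx => by simp [hx.symm]) (by simp)]
    refine Finset.sum_congr rfl fun b _ => ?_
    rw [if_pos rfl]
    exact congrArg _ (embed_update Q c hc 0 b)
  · push Not at hc
    obtain ⟨i, hi, hci⟩ := hc
    have h1 := act_mem_van (l := .u1 A 0) (j := i) (by simp [hl]; omega) (embed_mem_van hi Q) true
    rw [h1 c (by simpa using hci), embed_mem_van hi _ c (by simpa using hci)]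

theorem act_u2_embed {n : ℕ} (Q : QState (n + 2)) (A : G.Bin) :
    act (.u2 A 0 1) true (embed Q) =
      embed (Q.apply2 (G.mat2 A : Matrix (Bool × Bool) (Bool × Bool) ℂ)) := by
  have hl : (.u2 A 0 1 : Lbl G).regs = {0, 1} := rfl
  funext c
  by_cases hc : ∀ i, n + 2 ≤ i → c i = false
  · rw [embed, if_pos hc]
    simp only [act, if_true, LinearMap.sum_apply, LinearMap.smul_apply, Finset.sum_apply,
      Pi.smul_apply, Module.End.mul_apply, E_apply, QState.apply2, smul_eq_mul]
    rw [Finset.sum_eq_single (c 0, c 1) (fun x _ hx => Finset.sum_eq_zero fun y _ => ?_) (by simp)]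
    · refine Finset.sum_congr rfl fun b _ => ?_
      rw [if_pos rfl, if_pos (Function.update_of_ne one_ne_zero _ _)]
      refine congrArg _ ?_
      rw [embed, if_pos fun i hi => by
        rw [Function.update_of_ne (by omega), Function.update_of_ne (by omega)]; exact hc i hi]
      refine congrArg Q.ofLp ((Function.update_comp_eq_of_injective _ Fin.val_injective
        (1 : Fin (n + 2)) _).trans 
        (congrArg (fun d : Fin (n + 2) → Bool => Function.update d 1 b.2) ?_))
      exact Function.update_comp_eq_of_injective c Fin.val_injective (0 : Fin (n + 2)) b.1
    · rw [Function.update_of_ne one_ne_zero]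
      have : ¬ (c 0 = x.1 ∧ c 1 = x.2) := fun h => hx (Prod.ext h.1.symm h.2.symm)
      by_cases h0 : c 0 = x.1
      · rw [if_pos h0, if_neg fun h1 => this ⟨h0, h1⟩, mul_zero]
      · rw [if_neg h0, mul_zero]
  · push Not at hc
    obtain ⟨i, hi, hci⟩ := hc
    have h1 := act_mem_van (l := .u2 A 0 1) (j := i) (by simp [hl]; omega) (embed_mem_van hi Q) true
    rw [h1 c (by simpa using hci), embed_mem_van hi _ c (by simpa using hci)]

/-! ### Values of programs -/

/-- The permutation of register names given by a re-indexing. -/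
def regPerm {n m : ℕ} (σ : Fin n ≃ Fin m) : Equiv.Perm ℕ where
  toFun := extendReg σ
  invFun := extendReg σ.symm
  left_inv := extendReg_symm σ
  right_inv := extendReg_symm σ.symm

theorem embed_reindex {n m : ℕ} (σ : Fin n ≃ Fin m) (Q : QState n) (R : QState m)
    (h : ∀ b, R b = Q fun i => b (σ i)) : embed R = perm (regPerm σ) (embed Q) := by
  have e : n = m := Fin.equiv_iff_eq.mp ⟨σ⟩
  subst e
  have e1 {i : ℕ} (hi : n ≤ i) : regPerm σ i = i := dif_neg (not_lt.mpr hi)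
  have e2 (i : Fin n) : regPerm σ i = σ i := dif_pos i.2
  funext c
  have hc : (∀ i, n ≤ i → c (regPerm σ i) = false) ↔ ∀ i, n ≤ i → c i = false :=
    forall₂_congr fun i hi => by rw [e1 hi]
  rw [perm_apply]
  by_cases h' : ∀ i, n ≤ i → c i = false
  · rw [embed, embed, if_pos h', if_pos (hc.mpr h'), h]
    simp only [e2]
  · rw [embed, embed, if_neg h', if_neg (mt hc.mp h')]

/-- The value of a raw program. -/
noncomputable def RawProgram.value (n : ℕ) (p : RawProgram G) : ℝ≥0∞ :=
  QLambda.value n (embed p.state) p.term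

theorem Reindex.exists_perm {p q : RawProgram G} (h : Reindex p q) :
    ∃ π : Equiv.Perm ℕ, embed q.state = perm π (embed p.state) ∧ q.term = mapReg π p.term := by
  obtain ⟨σ, hs, ht⟩ := h
  exact ⟨regPerm σ, embed_reindex σ _ _ hs, ht⟩

theorem Reindex.value_eq {p q : RawProgram G} (h : Reindex p q) (n : ℕ) :
    p.value n = q.value n := by
  obtain ⟨π, hs, ht⟩ := h.exists_perm
  rw [RawProgram.value, RawProgram.value, hs, ht, value_perm]

theorem Reindex.SN_iff {p q : RawProgram G} (h : Reindex p q) : SN p.term ↔ SN q.term := by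
  obtain ⟨π, -, ht⟩ := h.exists_perm
  rw [ht, SN_mapReg]

/-- The probability that a program is in surface normal form after `n` strict surface steps. -/
noncomputable def Program.value (n : ℕ) (e : Program G) : ℝ≥0∞ :=
  Quotient.lift (RawProgram.value n) (fun _ _ h => Reindex.value_eq h n) e

/-- The limit probability of termination of a program. -/
noncomputable def Program.limValue (e : Program G) : ℝ≥0∞ := ⨆ n, e.value n

theorem RawProgram.good (p : RawProgram G) : Good (embed p.state) p.term := by
  refine ⟨p.valid, fun i hi => embed_mem_van ?_ _⟩
  by_contra h
  have := (p.regs i).mpr (not_le.mp h)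
  omega

theorem RawProgram.fresh (p : RawProgram G) : regOcc p.size p.term = 0 := by
  by_contra h
  exact lt_irrefl _ ((p.regs p.size).mp (Nat.pos_of_ne_zero h))

/-! ### Steps of programs as labelled steps -/

theorem SStep.fill {R : Term G} {l : Lbl G} {T} (h : SStep R l T) {C : Ctx G} (hC : C.IsSurface) :
    SStep (C.fill R) l fun k b => C.fill (T k b) := by
  induction C with
  | hole => exact h
  | appR M C ih => exact .appR _ (ih hC)
  | appL C M ih => exact .appL _ (ih hC)
  | lam C ih => exact .lam (ih hC)
  | blam C ih => exact .blam (ih hC)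
  | measS C M N ih => exact .measS _ _ (ih hC)
  | _ => exact hC.elim

/-- The sum of the values of weighted configurations. -/
noncomputable def confSum (w : St → Term G → ℝ≥0∞) (m : Multiset (ℝ × Conf G)) : ℝ≥0∞ :=
  (m.map fun x => ENNReal.ofReal x.1 * w (embed x.2.state) x.2.term).sum

/-- Quadratic functions of states. -/
def Quadratic (w : St → Term G → ℝ≥0∞) : Prop :=
  ∀ (a : ℂ) Q M, w (a • Q) M = ‖a‖ₑ ^ 2 * w Q M

theorem Quadratic.zero {w : St → Term G → ℝ≥0∞} (hw : Quadratic w) (M : Term G) : w 0 M = 0 := by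
  have := hw 0 0 M
  simpa using this

theorem Quadratic.stepVal {w : St → Term G → ℝ≥0∞} (hw : Quadratic w) {l : Lbl G} (Q : St)
    (hl : act l false Q = 0) (T : Bool → Term G) :
    stepVal w Q l T = w (act l true Q) (T true) := by
  simp [QLambda.stepVal, hl, hw.zero]

/-- A quadratic function absorbs the weight `‖a‖ ^ 2` into the state. If `a = 0` both sides vanish,
so omitting outcomes of weight `0` is harmless. -/
theorem confSum_outcome {w : St → Term G → ℝ≥0∞} (hw : Quadratic w) (a : ℂ) (c : Conf G)
    (F : Term G → Term G) :
    confSum w ((outcome (‖a‖ ^ 2) c).map fun x => (x.1, ⟨x.2.size, x.2.state, F x.2.term⟩)) =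
      w (a • embed c.state) (F c.term) := by
  rw [hw, outcome]
  split_ifs with h
  · have : a = 0 := by simpa using h
    simp [confSum, this]
  · simp [confSum, ENNReal.ofReal_pow]

/-- This is the dictionary from the given rules to labelled steps. Testing against quadratic
functions compares normalized weighted outcomes with unnormalized states. -/
theorem Closure.sstep {n : ℕ} {Q : QState n} {M : Term G} {m : Multiset (ℝ × Conf G)}
    (h : Closure Ctx.IsSurface RootBeta ⟨n, Q, M⟩ m ∨ Closure Ctx.IsSurface RootQ ⟨n, Q, M⟩ m) :
    ∃ l T, SStep M l T ∧ ∀ w, Quadratic w → confSum w m = stepVal w (embed Q) l (T n) := by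
  rcases h with h | h
  · rcases h with ⟨C, _, R, m, hC, hR⟩
    cases hR with
    | b _ A B =>
      refine ⟨_, _, (SStep.beta A B).fill hC, fun w hw => ?_⟩
      rw [hw.stepVal _ (by simp [act])]
      simp [confSum, act]
    | bb _ A B =>
      refine ⟨_, _, (SStep.bbeta A B).fill hC, fun w hw => ?_⟩
      rw [hw.stepVal _ (by simp [act])]
      simp [confSum, act]
  · rcases h with ⟨C, _, R, m, hC, hR⟩
    cases hR with
    | n =>
      refine ⟨_, _, SStep.new.fill hC, fun w hw => ?_⟩
      rw [hw.stepVal _ (by simp [act])]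
      simp [confSum, act, embed_snoc_false]
    | m _ a₀ a₁ Q₀ Q₁ A B h₀ h₁ hQ =>
      refine ⟨_, _, (SStep.meas _ A B).fill hC, fun w hw => ?_⟩
      subst hQ
      rw [Multiset.map_add, confSum, Multiset.map_add, Multiset.sum_add]
      refine (congrArg₂ (· + ·) (confSum_outcome hw a₀ ⟨_, Q₀, A⟩ C.fill)
        (confSum_outcome hw a₁ ⟨_, Q₁, B⟩ C.fill)).trans ?_
      simp [stepVal, act_meas_embed, add_comm]
    | u1 _ A =>
      refine ⟨_, _, (SStep.u1 A 0).fill hC, fun w hw => ?_⟩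
      rw [hw.stepVal _ (by simp [act]), act_u1_embed]
      simp [confSum]
    | u2 _ A =>
      refine ⟨_, _, (SStep.u2 A 0 1).fill hC, fun w hw => ?_⟩
      rw [hw.stepVal _ (by simp [act]), act_u2_embed]
      simp [confSum, pair, Term.rename]

theorem Par.fill {R R' : Term G} (h : Par R R') (C : Ctx G) : Par (C.fill R) (C.fill R') := by
  induction C with
  | hole => exact h
  | appR M C ih => exact .app (.refl _) ih
  | appL C M ih => exact .app ih (.refl _)
  | lam C ih => exact .lam ih
  | blam C ih => exact .blam ih
  | measS C M N ih => exact .meas ih (.refl _) (.refl _)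
  | measL P C N ih => exact .meas (.refl _) ih (.refl _)
  | measR P M C ih => exact .meas (.refl _) (.refl _) ih
  | bang C ih => exact .bang ih

theorem Closure.par {n : ℕ} {Q : QState n} {M : Term G} {m : Multiset (ℝ × Conf G)}
    (h : Closure (fun _ => True) RootBeta ⟨n, Q, M⟩ m) :
    ∃ M', Par M M' ∧ m = {(1, ⟨n, Q, M'⟩)} := by
  rcases h with ⟨C, _, R, m, -, hR⟩
  cases hR with
  | b _ A B => exact ⟨_, (Par.beta (.refl A) (.refl B)).fill C, by simp⟩
  | bb _ A B => exact ⟨_, (Par.bbeta (.refl A) (.refl B)).fill C, by simp⟩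

/-- The expectation of `g`. -/
noncomputable def expect (g : Program G → ℝ≥0∞) (m : Multiset (ℝ × Program G)) : ℝ≥0∞ :=
  (m.map fun x => ENNReal.ofReal x.1 * g x.2).sum

theorem SurfStep.exists_raw {e : Program G} {m : MDist G} (h : SurfStep e m) :
    ∃ (p : RawProgram G) (l : Multiset (ℝ × RawProgram G)), p.toProgram = e ∧
      (Closure Ctx.IsSurface RootBeta p.toConf (l.map fun x => (x.1, x.2.toConf)) ∨
        Closure Ctx.IsSurface RootQ p.toConf (l.map fun x => (x.1, x.2.toConf))) ∧
      m.1 = l.map fun x => (x.1, x.2.toProgram) := by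
  rcases h with ⟨p, l, hp, hr, hm⟩ | ⟨p, l, hp, hr, hm⟩
  · exact ⟨p, l, hp, .inl hr, hm⟩
  · exact ⟨p, l, hp, .inr hr, hm⟩

theorem quadratic_value (n : ℕ) : Quadratic (value n : St → Term G → ℝ≥0∞) :=
  fun a Q M => value_smul a n Q M

theorem SurfStep.value_eq {e : Program G} {m : MDist G} (h : SurfStep e m) (n : ℕ) :
    e.value (n + 1) = expect (Program.value n) m.1 := by
  obtain ⟨p, l, rfl, hr, hm⟩ := h.exists_raw
  obtain ⟨lb, T, hs, hv⟩ := Closure.sstep hr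
  have h1 : p.toProgram.value (n + 1) = QLambda.value (n + 1) (embed p.state) p.term := rfl
  rw [h1, value_succ p.good hs p.fresh n, ← hv _ (quadratic_value n), hm, expect, confSum,
    Multiset.map_map, Multiset.map_map]
  rfl

theorem Program.value_mono (e : Program G) : Monotone fun n => e.value n := by
  induction e using Quotient.inductionOn with
  | h p => exact QLambda.value_mono _ _

theorem expect_iSup {g : ℕ → Program G → ℝ≥0∞} (hg : ∀ e, Monotone fun n => g n e)
    (m : Multiset (ℝ × Program G)) : expect (fun e => ⨆ n, g n e) m = ⨆ n, expect (g n) m := by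
  induction m using Multiset.induction with
  | empty => simp [expect]
  | cons a m ih =>
    simp only [expect, Multiset.map_cons, Multiset.sum_cons] at ih ⊢
    rw [ih, ENNReal.mul_iSup, ENNReal.iSup_add_iSup_of_monotone]
    · exact fun i j hij => mul_le_mul_right (hg _ hij) _
    · exact fun i j hij => Multiset.sum_map_le_sum_map _ _
        fun x _ => mul_le_mul_right (hg _ hij) _

theorem SurfStep.limValue_eq {e : Program G} {m : MDist G} (h : SurfStep e m) :
    e.limValue = expect Program.limValue m.1 := by
  have e1 : e.limValue = ⨆ n, e.value (n + 1) := (e.value_mono.iSup_nat_add 1).symm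
  rw [e1]
  simp only [h.value_eq]
  exact (expect_iSup Program.value_mono _).symm

theorem Step.expect_limValue_le {e : Program G} {m : MDist G} (h : Step e m) :
    expect Program.limValue m.1 ≤ e.limValue := by
  rcases h with ⟨p, l, rfl, hr, hm⟩ | h
  · obtain ⟨M', hp, hl⟩ := Closure.par hr
    obtain ⟨x, rfl, hx⟩ := Multiset.map_eq_singleton.mp hl
    obtain ⟨w, ⟨⟨n, Q, M⟩, h1, h2, h3⟩⟩ := x
    simp only [Prod.mk.injEq] at hx
    obtain ⟨rfl, hx⟩ := hx
    have := hp.limValue_le p.good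
    rw [hm]
    simp only [Multiset.map_singleton, expect, Multiset.sum_singleton, ENNReal.ofReal_one, one_mul]
    obtain ⟨⟨n', Q', N⟩, _, _, _⟩ := p
    cases hx
    exact this
  · exact (SurfStep.limValue_eq (.inr h)).ge

/-! ### Labelled steps as steps of programs -/

/-- Surface steps at the root. -/
inductive RootStep : Term G → Lbl G → (ℕ → Bool → Term G) → Prop
  | beta (M N : Term G) : RootStep (app (lam M) N) .beta fun _ _ => inst M N
  | bbeta (M N : Term G) : RootStep (app (blam M) (bang N)) .beta fun _ _ => inst M N
  | new : RootStep new .new fun k _ => reg k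
  | meas (i : ℕ) (M N : Term G) : RootStep (meas (reg i) M N) (.meas i) fun _ b => cond b N M
  | u1 (A : G.Un) (i : ℕ) : RootStep (app (gate1 A) (reg i)) (.u1 A i) fun _ _ => reg i
  | u2 (A : G.Bin) (i j : ℕ) :
      RootStep (app (gate2 A) (pair (reg i) (reg j))) (.u2 A i j) fun _ _ => pair (reg i) (reg j)

theorem SStep.exists_ctx {M : Term G} {l : Lbl G} {T} (h : SStep M l T) :
    ∃ (C : Ctx G) (R : Term G) (T' : ℕ → Bool → Term G), C.IsSurface ∧ M = C.fill R ∧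
      T = (fun k b => C.fill (T' k b)) ∧ RootStep R l T' := by
  induction h with
  | beta M N => exact ⟨.hole, _, _, trivial, rfl, rfl, .beta M N⟩
  | bbeta M N => exact ⟨.hole, _, _, trivial, rfl, rfl, .bbeta M N⟩
  | new => exact ⟨.hole, _, _, trivial, rfl, rfl, .new⟩
  | meas i M N => exact ⟨.hole, _, _, trivial, rfl, rfl, .meas i M N⟩
  | u1 A i => exact ⟨.hole, _, _, trivial, rfl, rfl, .u1 A i⟩
  | u2 A i j => exact ⟨.hole, _, _, trivial, rfl, rfl, .u2 A i j⟩
  | appL N h ih =>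
    obtain ⟨C, R, T', hC, rfl, rfl, hR⟩ := ih
    exact ⟨.appL C N, R, T', hC, rfl, rfl, hR⟩
  | appR M h ih =>
    obtain ⟨C, R, T', hC, rfl, rfl, hR⟩ := ih
    exact ⟨.appR M C, R, T', hC, rfl, rfl, hR⟩
  | lam h ih =>
    obtain ⟨C, R, T', hC, rfl, rfl, hR⟩ := ih
    exact ⟨.lam C, R, T', hC, rfl, rfl, hR⟩
  | blam h ih =>
    obtain ⟨C, R, T', hC, rfl, rfl, hR⟩ := ih
    exact ⟨.blam C, R, T', hC, rfl, rfl, hR⟩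
  | measS M N h ih =>
    obtain ⟨C, R, T', hC, rfl, rfl, hR⟩ := ih
    exact ⟨.measS C M N, R, T', hC, rfl, rfl, hR⟩

/-! ### Re-indexing a program so that a labelled step becomes a root rule -/

theorem cnt_mapReg (all : Bool) (f g r : ℕ → ℕ) (M : Term G) :
    cnt all f g (mapReg r M) = cnt all f (fun i => g (r i)) M := by
  cases all <;> induction M generalizing f <;> simp_all [cnt, mapReg]

theorem Term.LinearLams.mapReg {M : Term G} (h : LinearLams M) (r : ℕ → ℕ) :
    LinearLams (mapReg r M) := by
  induction M with
  | lam M ih =>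
    simp only [LinearLams, ← cnt_unitW_true, ← cnt_unitW_false, Term.mapReg, cnt_mapReg] at h ⊢
    exact ⟨h.1, h.2.1, ih h.2.2⟩
  | _ => simp_all [LinearLams, Term.mapReg]

theorem regSurfOcc_mapReg (π : Equiv.Perm ℕ) (k : ℕ) (M : Term G) :
    regSurfOcc (π k) (mapReg π M) = regSurfOcc k M := by
  induction M <;> simp_all [mapReg, regSurfOcc]

theorem Term.Valid.mapReg {M : Term G} (h : Valid M) (π : Equiv.Perm ℕ) : Valid (mapReg π M) := by
  refine ⟨fun i => ?_, LinearLams.mapReg h.2 _⟩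
  have := h.1 (π.symm i)
  rwa [← regOcc_mapReg π, ← regSurfOcc_mapReg π, π.apply_symm_apply] at this

theorem RawProgram.exists_reindex (p : RawProgram G) (σ : Equiv.Perm (Fin p.size)) :
    ∃ q : RawProgram G, q.toProgram = p.toProgram ∧ q.size = p.size ∧
      q.term = mapReg (regPerm σ) p.term := by
  let Q : QState p.size := WithLp.toLp 2 fun b => p.state fun i => b (σ i)
  have hQ : ‖Q‖ = 1 := by
    rw [← p.norm_state, ← sq_eq_sq₀ (norm_nonneg _) (norm_nonneg _), EuclideanSpace.norm_sq_eq,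
      EuclideanSpace.norm_sq_eq]
    exact (σ.symm.arrowCongr (Equiv.refl Bool)).sum_comp fun b => ‖p.state b‖ ^ 2
  let q : RawProgram G := ⟨⟨p.size, Q, mapReg (regPerm σ) p.term⟩, hQ, p.valid.mapReg _, fun i => by
    dsimp only
    obtain ⟨j, rfl⟩ := (regPerm σ).surjective i
    rw [regOcc_mapReg, p.regs]
    change j < p.size ↔ extendReg σ j < p.size
    unfold extendReg
    split_ifs with h <;> simp [h]⟩
  have hpq : Reindex p q := ⟨σ, fun _ => rfl, rfl⟩
  exact ⟨q, (Quotient.sound hpq).symm, rfl, rfl⟩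

namespace Lbl

/-- The registers of the label are those of a root rule for `n` qubits. -/
def Canonical (n : ℕ) : Lbl G → Prop
  | meas i => i + 1 = n
  | u1 _ i => i = 0
  | u2 _ i j => i = 0 ∧ j = 1
  | _ => True

theorem exists_canonical {n : ℕ} (l : Lbl G) (hl : ∀ i ∈ l.regs, i < n)
    (hd : ∀ A i j, l = .u2 A i j → i ≠ j) :
    ∃ σ : Equiv.Perm (Fin n), (l.map (regPerm σ)).Canonical n := by
  have ext (σ : Equiv.Perm (Fin n)) (i : ℕ) (hi : i < n) : regPerm σ i = σ ⟨i, hi⟩ := dif_pos hi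
  cases l with
  | beta => exact ⟨1, trivial⟩
  | new => exact ⟨1, trivial⟩
  | meas i =>
    have hi := hl i (by simp [regs])
    refine ⟨Equiv.swap ⟨i, hi⟩ ⟨n - 1, by omega⟩, ?_⟩
    simp only [map, Canonical, ext _ i hi, Equiv.swap_apply_left]
    omega
  | u1 A i =>
    have hi := hl i (by simp [regs])
    refine ⟨Equiv.swap ⟨i, hi⟩ ⟨0, by omega⟩, ?_⟩
    simp only [map, Canonical, ext _ i hi, Equiv.swap_apply_left]
  | u2 A i j =>
    have hi := hl i (by simp [regs])
    have hj := hl j (by simp [regs])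
    have hij := hd A i j rfl
    let x : Fin n := ⟨i, hi⟩
    let y : Fin n := ⟨j, hj⟩
    let z : Fin n := ⟨0, by omega⟩
    let w : Fin n := ⟨1, by omega⟩
    have hxy : x ≠ y := fun h => hij (congrArg Fin.val h)
    have hzw : z ≠ w := fun h => zero_ne_one (congrArg Fin.val h)
    have hz : Equiv.swap x z y ≠ z := fun h =>
      hxy ((Equiv.swap x z).injective (h.trans (Equiv.swap_apply_left x z).symm)).symm
    -- The first swap sends `i` to `0`. The second sends the image of `j` to `1` and fixes `0`,
    -- because `i ≠ j`.
    refine ⟨(Equiv.swap x z).trans (Equiv.swap (Equiv.swap x z y) w), ?_, ?_⟩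
    · rw [ext _ i hi, Equiv.trans_apply, Equiv.swap_apply_left,
        Equiv.swap_apply_of_ne_of_ne hz.symm hzw]
    · rw [ext _ j hj, Equiv.trans_apply]
      exact congrArg Fin.val (Equiv.swap_apply_left (Equiv.swap x z y) w)

end Lbl

theorem SStep.u2_ne {M : Term G} {l : Lbl G} {T} (h : SStep M l T) (hr : ∀ i, regSurfOcc i M ≤ 1)
    {A : G.Bin} {i j : ℕ} (hl : l = .u2 A i j) : i ≠ j := by
  rintro rfl
  have : 2 ≤ regSurfOcc i M := by
    clear hr
    induction h with
    | u2 => cases hl; simp [regSurfOcc]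
    | appL N h ih => have := ih hl; simp only [regSurfOcc]; omega
    | appR M h ih => have := ih hl; simp only [regSurfOcc]; omega
    | lam h ih => exact ih hl
    | blam h ih => exact ih hl
    | measS M N h ih => exact ih hl
    | _ => simp at hl
  have := hr i
  omega

theorem surfStep_dirac {p q : RawProgram G}
    (h : Closure Ctx.IsSurface RootBeta p.toConf {(1, q.toConf)} ∨
      Closure Ctx.IsSurface RootQ p.toConf {(1, q.toConf)}) :
    SurfStep p.toProgram (MDist.dirac q.toProgram) :=
  h.imp (fun h => ⟨p, {(1, q)}, rfl, by simpa using h, by simp [MDist.dirac]⟩)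
    fun h => ⟨p, {(1, q)}, rfl, by simpa using h, by simp [MDist.dirac]⟩

theorem exists_measStep {p : RawProgram G} (q : Bool → RawProgram G) (a : Bool → ℂ)
    (ha : ‖a false‖ ^ 2 + ‖a true‖ ^ 2 = 1)
    (h : Closure Ctx.IsSurface RootQ p.toConf
      (outcome (‖a false‖ ^ 2) (q false).toConf + outcome (‖a true‖ ^ 2) (q true).toConf)) :
    ∃ m, SurfStep p.toProgram m := by
  classical
  let out (b : Bool) : Multiset (ℝ × RawProgram G) :=
    if ‖a b‖ ^ 2 = 0 then 0 else {(‖a b‖ ^ 2, q b)}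
  have ho (b : Bool) : (out b).map (fun x => (x.1, x.2.toConf)) =
      outcome (‖a b‖ ^ 2) (q b).toConf := by
    simp only [out, outcome]
    split_ifs <;> simp
  have hw (b : Bool) : ∀ x ∈ out b, 0 < x.1 ∧ x.1 ≤ 1 := by
    intro x hx
    simp only [out] at hx
    split_ifs at hx with h0
    · simp at hx
    · rw [Multiset.mem_singleton] at hx
      subst hx
      have h1 := sq_nonneg ‖a false‖
      have h2 := sq_nonneg ‖a true‖
      refine ⟨lt_of_le_of_ne (sq_nonneg _) (Ne.symm h0), ?_⟩
      cases b <;> dsimp only <;> linarith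
  have hs (b : Bool) : ((out b).map Prod.fst).sum = ‖a b‖ ^ 2 := by
    simp only [out]
    split_ifs with h0
    · simp [h0]
    · simp
  refine ⟨⟨(out false + out true).map fun x => (x.1, x.2.toProgram), ?_, ?_⟩,
    .inr ⟨p, out false + out true, rfl, ?_, rfl⟩⟩
  · intro x hx
    obtain ⟨y, hy, rfl⟩ := Multiset.mem_map.mp hx
    exact (Multiset.mem_add.mp hy).elim (hw false y) (hw true y)
  · rw [Multiset.map_map]
    change ((out false + out true).map Prod.fst).sum ≤ 1
    rw [Multiset.map_add, Multiset.sum_add, hs, hs, ha]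
  · rw [Multiset.map_add, ho, ho]
    exact h

theorem RawProgram.exists_surfStep_of_canonical (p : RawProgram G) {l : Lbl G} {T}
    (h : SStep p.term l T) (hl : l.Canonical p.size) : ∃ m, SurfStep p.toProgram m := by
  -- Conservation of register counts shows that the registers of each reduct form an initial
  -- segment: allocation adds the name `n`, measurement removes the last one.
  have hocc (b : Bool) (i : ℕ) := h.regOcc_reduct p.valid p.size b i
  have hval (b : Bool) := h.valid p.valid p.fresh b
  have hpos {i : ℕ} (hi : i ∈ l.regs) : i < p.size :=
    (p.regs i).mp ((h.regSurfOcc_pos hi).trans_le (SStep.regSurfOcc_le _ _))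
  obtain ⟨C, R, T', hC, hM, rfl, hR⟩ := h.exists_ctx
  obtain ⟨⟨n, Q, M⟩, hn, hv, hr⟩ := p
  dsimp only at *
  subst hM
  cases hR with
  | beta A B =>
    let q : RawProgram G := ⟨⟨n, Q, C.fill (inst A B)⟩, hn, hval true, fun i => by
      rw [← hr i]
      have := hocc true i
      simp only [Lbl.loss, Lbl.gain] at this
      dsimp only
      omega⟩
    exact ⟨_, surfStep_dirac (q := q) (.inl (by simpa using Closure.mk C Q _ _ hC (RootBeta.b Q A B)))⟩
  | bbeta A B =>
    let q : RawProgram G := ⟨⟨n, Q, C.fill (inst A B)⟩, hn, hval true, fun i => by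
      rw [← hr i]
      have := hocc true i
      simp only [Lbl.loss, Lbl.gain] at this
      dsimp only
      omega⟩
    exact ⟨_, surfStep_dirac (q := q) (.inl (by simpa using Closure.mk C Q _ _ hC (RootBeta.bb Q A B)))⟩
  | new =>
    have hQ : ‖Q.snoc false‖ = 1 := by
      have h1 := nsq_embed (Q.snoc false)
      rw [embed_snoc_false, nsq_embed, hn] at h1
      have h2 := (ENNReal.ofReal_eq_ofReal_iff (by norm_num) (sq_nonneg _)).mp h1
      exact (pow_eq_one_iff_of_nonneg (norm_nonneg _) two_ne_zero).mp (by linarith)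
    let q : RawProgram G := ⟨⟨n + 1, Q.snoc false, C.fill (reg n)⟩, hQ, hval true, fun i => by
      have h1 : 0 < regOcc i (C.fill new) ↔ i < n := hr i
      have := hocc true i
      simp only [Lbl.loss, Lbl.gain, unitW] at this
      dsimp only
      split_ifs at this <;> omega⟩
    exact ⟨_, surfStep_dirac (q := q) (.inr (by simpa using Closure.mk C Q _ _ hC (RootQ.n Q)))⟩
  | meas i A B =>
    obtain rfl : i + 1 = n := hl
    obtain ⟨Q₀, h₀, e₀⟩ := (Q.comp false).exists_unit
    obtain ⟨Q₁, h₁, e₁⟩ := (Q.comp true).exists_unit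
    let q (b : Bool) : RawProgram G :=
      ⟨⟨i, cond b Q₁ Q₀, C.fill (cond b B A)⟩, by cases b <;> assumption, hval b, fun j => by
        have h1 : 0 < regOcc j (C.fill (Term.meas (reg i) A B)) ↔ j < i + 1 := hr j
        have h2 := hocc b j
        have h3 : regOcc j (C.fill (Term.meas (reg i) A B)) ≤ 1 := (hv.1 j).1
        simp only [Lbl.loss, Lbl.gain, unitW] at h2
        dsimp only
        split_ifs at h2 <;> omega⟩
    refine exists_measStep q (fun b => (‖Q.comp b‖ : ℂ)) ?_ ?_
    · simpa [hn] using Q.norm_sq_comp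
    · have hQ : Q = (‖Q.comp false‖ : ℂ) • Q₀.snoc false + (‖Q.comp true‖ : ℂ) • Q₁.snoc true := by
        conv_lhs => rw [Q.eq_snoc_add_snoc, e₀, e₁, QState.snoc_smul, QState.snoc_smul]
      have := Closure.mk C Q _ _ hC (RootQ.m Q _ _ Q₀ Q₁ A B h₀ h₁ hQ)
      rw [Multiset.map_add] at this
      convert this using 2 <;>
      · simp only [outcome]
        split_ifs <;> simp [q]
  | u1 A i =>
    obtain rfl : i = 0 := hl
    obtain ⟨n, rfl⟩ : ∃ k, n = k + 1 := ⟨n - 1, by have := hpos (i := 0) (by simp [Lbl.regs]); omega⟩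
    let q : RawProgram G := ⟨⟨n + 1, Q.apply1 (G.mat1 A : Matrix Bool Bool ℂ), C.fill (reg 0)⟩,
      (QState.norm_apply1 _ _).trans hn, hval true, fun i => by
      rw [← hr i]
      have := hocc true i
      simp only [Lbl.loss, Lbl.gain] at this
      dsimp only
      omega⟩
    exact ⟨_, surfStep_dirac (q := q) (.inr (by simpa using Closure.mk C Q _ _ hC (RootQ.u1 Q A)))⟩
  | u2 A i j =>
    obtain ⟨rfl, rfl⟩ : i = 0 ∧ j = 1 := hl
    obtain ⟨n, rfl⟩ : ∃ k, n = k + 2 := ⟨n - 2, by have := hpos (i := 1) (by simp [Lbl.regs]); omega⟩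
    let q : RawProgram G := ⟨⟨n + 2, Q.apply2 (G.mat2 A : Matrix (Bool × Bool) (Bool × Bool) ℂ),
      C.fill (pair (reg 0) (reg 1))⟩,
      (QState.norm_apply2 _ _).trans hn, hval true, fun i => by
      rw [← hr i]
      have := hocc true i
      simp only [Lbl.loss, Lbl.gain] at this
      dsimp only
      omega⟩
    exact ⟨_, surfStep_dirac (q := q) (.inr (by simpa using Closure.mk C Q _ _ hC (RootQ.u2 Q A)))⟩

/-- A labelled step may act on arbitrary registers, so a representative on which it is literally one
of the root rules has to be chosen first. Conversely, `SN` is invariant under re-indexing, so a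
program step on any representative is enough. -/
theorem RawProgram.SNF_iff (p : RawProgram G) : SNF p.toProgram ↔ SN p.term := by
  refine ⟨fun h l T hs => h ?_, fun h ⟨m, hm⟩ => ?_⟩
  · obtain ⟨σ, hσ⟩ := l.exists_canonical (n := p.size)
      (fun i hi => (p.regs i).mp ((hs.regSurfOcc_pos hi).trans_le (SStep.regSurfOcc_le _ _)))
      fun A i j hl => hs.u2_ne (fun i => (p.valid.1 i).2 ▸ (p.valid.1 i).1) hl
    obtain ⟨q, hq, hn, ht⟩ := p.exists_reindex σ
    have := hs.mapReg (regPerm σ)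
    rw [← hq]
    rw [← ht] at this
    exact q.exists_surfStep_of_canonical this (by rwa [hn])
  · obtain ⟨q, l, hq, hr, -⟩ := hm.exists_raw
    obtain ⟨lb, T, hs, -⟩ := Closure.sstep hr
    exact ((Quotient.exact hq : Reindex q p).SN_iff.mpr h) _ _ hs

theorem Program.value_of_SNF {e : Program G} (h : SNF e) (n : ℕ) : e.value n = 1 := by
  induction e using Quotient.inductionOn with
  | h p =>
    refine (value_of_SN ((RawProgram.SNF_iff p).mp h) n _).trans ?_
    simp [nsq_embed, p.norm_state]

theorem Program.value_zero_of_not_SNF {e : Program G} (h : ¬ SNF e) : e.value 0 = 0 := by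
  induction e using Quotient.inductionOn with
  | h p => exact if_neg fun hs => h ((RawProgram.SNF_iff p).mpr hs)

/-! ### Reduction sequences -/

/-- For normalized states, the value at `0` is the indicator function of surface normal forms. -/
theorem ofReal_prob (m : MDist G) : ENNReal.ofReal m.prob = expect (Program.value 0) m.1 := by
  classical
  have key (s : Multiset (ℝ × Program G)) (hs : ∀ x ∈ s, 0 < x.1) :
      0 ≤ (s.map fun x => if SNF x.2 then x.1 else 0).sum ∧
      ENNReal.ofReal (s.map fun x => if SNF x.2 then x.1 else 0).sum =
        expect (Program.value 0) s := by
    induction s using Multiset.induction with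
    | empty => simp [expect]
    | cons a s ih =>
      obtain ⟨h1, h2⟩ := ih fun x hx => hs x (Multiset.mem_cons_of_mem hx)
      have ha := (hs a (Multiset.mem_cons_self a s)).le
      simp only [expect, Multiset.map_cons, Multiset.sum_cons] at h2 ⊢
      by_cases h : SNF a.2
      · rw [if_pos h, Program.value_of_SNF h, mul_one, ENNReal.ofReal_add ha h1, h2]
        exact ⟨by positivity, rfl⟩
      · rw [if_neg h, Program.value_zero_of_not_SNF h, mul_zero, zero_add, zero_add, h2]
        exact ⟨h1, rfl⟩
  have := (key m.1 fun x hx => (m.2.1 x hx).1).2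
  rw [← this, MDist.prob]

theorem prob_le_one (m : MDist G) : m.prob ≤ 1 := by
  classical
  refine le_trans ?_ m.2.2
  rw [MDist.prob]
  refine Multiset.sum_map_le_sum_map _ _ fun x hx => ?_
  split_ifs
  · exact le_rfl
  · exact (m.2.1 x hx).1.le

theorem expect_dirac (g : Program G → ℝ≥0∞) (e : Program G) :
    expect g (MDist.dirac e).1 = g e := by
  simp [expect, MDist.dirac]

theorem expect_sum (g : Program G → ℝ≥0∞) (l : Multiset (ℝ × Program G × MDist G))
    (hl : ∀ x ∈ l, 0 ≤ x.1) :
    expect g (l.map fun x => x.2.2.1.map fun y => (x.1 * y.1, y.2)).sum =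
      (l.map fun x => ENNReal.ofReal x.1 * expect g x.2.2.1).sum := by
  induction l using Multiset.induction with
  | empty => simp [expect]
  | cons a l ih =>
    have ih := ih fun x hx => hl x (Multiset.mem_cons_of_mem hx)
    simp only [expect, Multiset.map_cons, Multiset.sum_cons, Multiset.map_add,
      Multiset.sum_add] at ih ⊢
    rw [ih, Multiset.map_map, ← Multiset.sum_map_mul_left]
    congr 2
    refine Multiset.map_congr rfl fun y _ => ?_
    simp [ENNReal.ofReal_mul (hl a (Multiset.mem_cons_self a l)), mul_assoc]

theorem weight_nonneg {m : MDist G} {l : Multiset (ℝ × Program G × MDist G)}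
    (hl : m.1 = l.map fun x => (x.1, x.2.1)) : ∀ x ∈ l, 0 ≤ x.1 := fun x hx =>
  (m.2.1 (x.1, x.2.1) (hl ▸ Multiset.mem_map_of_mem (fun x => (x.1, x.2.1)) hx)).1.le

theorem Red.expect_limValue_le {m m' : MDist G} (h : Red m m') :
    expect Program.limValue m'.1 ≤ expect Program.limValue m.1 := by
  obtain ⟨l, hl, hs, hm'⟩ := h
  rw [hm', expect_sum _ _ (weight_nonneg hl), hl, expect, Multiset.map_map]
  refine Multiset.sum_map_le_sum_map _ _ fun x hx => mul_le_mul_right ?_ _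
  rcases hs x hx with ⟨-, h⟩ | h
  · rw [h, expect_dirac]
  · exact h.expect_limValue_le

/-- Strictness is what makes this exact: a program that stays put is normal, with value `1` at every
index, and every other program uses up one step. -/
theorem StrictSurfRed.expect_value_succ {m m' : MDist G} (h : StrictSurfRed m m') (n : ℕ) :
    expect (Program.value (n + 1)) m.1 = expect (Program.value n) m'.1 := by
  obtain ⟨l, hl, hs, hm'⟩ := h
  rw [hm', expect_sum _ _ (weight_nonneg hl), hl, expect, Multiset.map_map]
  refine congrArg Multiset.sum (Multiset.map_congr rfl fun x hx =>
    congrArg (ENNReal.ofReal x.1 * ·) ?_)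
  dsimp only
  rcases hs x hx with ⟨hn, h⟩ | h
  · rw [h, expect_dirac, Program.value_of_SNF hn, Program.value_of_SNF hn]
  · exact h.value_eq n

theorem exists_strictSurfRed (m : MDist G) : ∃ m', StrictSurfRed m m' := by
  have h (e : Program G) : ∃ n : MDist G, (SNF e ∧ n = MDist.dirac e) ∨ SurfStep e n := by
    by_cases he : SNF e
    · exact ⟨_, .inl ⟨he, rfl⟩⟩
    · obtain ⟨n, hn⟩ := not_not.mp he
      exact ⟨n, .inr hn⟩
  choose next hnext using h
  refine ⟨⟨m.1.bind fun x => (next x.2).1.map fun y => (x.1 * y.1, y.2), ?_, ?_⟩,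
    m.1.map fun x => (x.1, x.2, next x.2), ?_, ?_, ?_⟩
  · intro z hz
    obtain ⟨x, hx, hz⟩ := Multiset.mem_bind.mp hz
    obtain ⟨y, hy, rfl⟩ := Multiset.mem_map.mp hz
    have h1 := m.2.1 x hx
    have h2 := (next x.2).2.1 y hy
    exact ⟨mul_pos h1.1 h2.1, mul_le_one₀ h1.2 h2.1.le h2.2⟩
  · rw [Multiset.map_bind, Multiset.sum_bind]
    refine le_trans (Multiset.sum_map_le_sum_map _ _ fun x hx => ?_) m.2.2
    rw [Multiset.map_map]
    refine (Multiset.sum_map_mul_left (f := fun y : ℝ × Program G => y.1)).trans_le ?_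
    exact mul_le_of_le_one_right (m.2.1 x hx).1.le (next x.2).2.2
  · simp
  · intro x hx
    obtain ⟨y, -, rfl⟩ := Multiset.mem_map.mp hx
    exact hnext y.2
  · rw [Multiset.map_map]
    rfl

theorem exists_sequence (m : MDist G) :
    ∃ f : ℕ → MDist G, f 0 = m ∧ ∀ k, StrictSurfRed (f k) (f (k + 1)) := by
  choose next hnext using fun m : MDist G => exists_strictSurfRed m
  exact ⟨fun k => next^[k] m, rfl, fun k => by
    dsimp only
    rw [Function.iterate_succ_apply']
    exact hnext _⟩

/-- The left side depends only on `f 0`. With `n = 0`, all strict sequences from one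
multidistribution thus have the same probability of normal forms at each stage. -/
theorem expect_value_of_sequence {f : ℕ → MDist G} (h : ∀ k, StrictSurfRed (f k) (f (k + 1)))
    (k n : ℕ) : expect (Program.value (n + k)) (f 0).1 = expect (Program.value n) (f k).1 := by
  induction k generalizing n with
  | zero => rfl
  | succ k ih =>
    rw [← (h k).expect_value_succ, ← ih]
    congr 2
    omega

end QLambda

open QLambda in
theorem mainTheorem6 (G : QLambda.GateSet) (m : QLambda.MDist G) (p : ℝ)
    (h : QLambda.ConvergesTo QLambda.Red m p) :
    ∃ q : ℝ, p ≤ q ∧ QLambda.ConvergesTo QLambda.StrictSurfRed m q := by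
  obtain ⟨f, rfl, hf, hp⟩ := h
  obtain ⟨g, hg0, hg⟩ := exists_sequence (f 0)
  have hbdd : BddAbove (Set.range fun k => (g k).prob) :=
    ⟨1, by rintro _ ⟨k, rfl⟩; exact prob_le_one _⟩
  have hlub := isLUB_ciSup hbdd
  refine ⟨_, hp.2 ?_, g, hg0, hg, hlub⟩
  rintro _ ⟨k, rfl⟩
  have h1 : expect Program.limValue (f k).1 ≤ expect Program.limValue (f 0).1 := by
    induction k with
    | zero => exact le_rfl
    | succ k ih => exact (hf k).expect_limValue_le.trans ih
  have h2 : ENNReal.ofReal (f k).prob ≤ expect Program.limValue (f k).1 := by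
    rw [ofReal_prob]
    exact Multiset.sum_map_le_sum_map _ _
      fun x _ => mul_le_mul_right (le_iSup (fun n => x.2.value n) 0) _
  have h3 : expect Program.limValue (f 0).1 ≤ ENNReal.ofReal (⨆ k, (g k).prob) := by
    have e : expect Program.limValue (f 0).1 = ⨆ n, expect (Program.value n) (f 0).1 :=
      expect_iSup Program.value_mono _
    rw [e, ← hg0]
    refine iSup_le fun n => ?_
    rw [← zero_add n, expect_value_of_sequence hg, ← ofReal_prob]
    exact ENNReal.ofReal_le_ofReal (le_ciSup hbdd n)
  -- `ENNReal.ofReal` truncates negative numbers, so the final comparison can be reflected to `ℝ`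
  -- only with a nonnegative right side.
  have h4 : 0 ≤ ⨆ k, (g k).prob := by
    classical
    refine le_trans ?_ (le_ciSup hbdd 0)
    rw [MDist.prob]
    refine Multiset.sum_nonneg fun x hx => ?_
    obtain ⟨y, hy, rfl⟩ := Multiset.mem_map.mp hx
    split_ifs
    exacts [((g 0).2.1 y hy).1.le, le_rfl]
  exact (ENNReal.ofReal_le_ofReal_iff h4).mp (h2.trans (h1.trans h3))
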